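/- Let $Z=(Z_t)_{t\ge 0}$ be a real-valued Lévy process without Gaussian component, $E e^{i\xi Z_t}=e^{-t\psi(\xi)}$, $$\psi(\xi)=ia\xi+\int_{\mathbb R}\bigl(1-e^{i\xi u}+i\xi u\,1_{|u|<1}\bigr)\mu(du),$$ where $a\in\mathbb R$ and $\mu$ is a Lévy measure ($\mu(\{0\})=0$, $\int(1\wedge u^2)\,\mu(du)<\infty$) with $\mu(\mathbb R)=\infty$. Put $$\psi^L(\xi)=\int_{|\xi u|<1}(\xi u)^2\mu(du),\qquad \psi^U(\xi)=\int_{\mathbb R}\bigl((\xi u)^2\wedge 1\bigr)\mu(du),$$ and assume condition A: there is $\beta>1$ such that $\psi^U(\xi)\le\beta\,\psi^L(\xi)$ for all $\xi\in\mathbb R$. For $t>0$ let $\rho_t=\inf\{\xi>0:\operatorname{Re}\psi(\xi)\ge 1/t\}$, $\Lambda_t(du)=t\,1_{\{|\rho_t u|>1\}}\,\mu(du)$, $$\psi_t(\xi)=t\int_{|\rho_t u|\le 1}\bigl(1-e^{i\xi u}+i\xi u\bigr)\mu(du),\qquad a_t=t\Bigl(a+\int_{\mathbb R}u\,\bigl(1_{|u|<1}-1_{|\rho_t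 u|\le 1}\bigr)\mu(du)\Bigr),$$ so that $t\psi(\xi)=\psi_t(\xi)+\int(1-e^{i\xi u})\Lambda_t(du)+i\xi a_t$. Then for every $t>0$ one has $\rho_t>0$; the law of $Z_t$ has a continuous density $p_t$; there is a probability law with characteristic function $e^{-\psi_t}$, and it has a continuous density $\bar p_t$; and $x_t=\min\{x:\bar p_t(x)=\max_{x'\in\mathbb R}\bar p_t(x')\}$ is well defined. Moreover, for every $t_0>0$ there exist constants $b_1,b_2,b_3,b_4>0$ such that for all $t\in(0,t_0]$ and $x\in\mathbb R$: (I) $$p_t(x-a_t)\le\sum_{m=0}^\infty\frac1{m!}\int_{\mathbb R}\rho_t\,f_{upper}\bigl((x-y)\rho_t\bigr)\,\Lambda_t^{*m}(dy),\qquad f_{upper}(x)=b_1e^{-b_2|x|};$$ (II) $$p_t(x-a_t+x_t)\ge\sum_{m=0}^\infty\frac1{m!}\int_{\mathbb R}\rho_t\,f_{lower}\bigl((x-y)\rho_t\bigr)\,\Lambda_t^{*m}(dy),\qquad f_{lower}(x)=b_3\,1_{|x|\le b_4}.$$ Here $\Lambda_t$ is a finite measure, $\Lambda_t^{*m}$ is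 its $m$-fold convolution power and $\Lambda_t^{*0}=\delta_0$; all the integrals and both series converge. -/

import Mathlib

open MeasureTheory ProbabilityTheory Filter Topology
open scoped NNReal ENNReal

noncomputable section

namespace LevyKernel

/-- `Z` is a real-valued Lévy process under `P`: it starts at `0`, has independent and stationary
increments, and is stochastically continuous. -/
structure IsLevyProcess {Ω : Type*} [MeasurableSpace Ω] (Z : ℝ≥0 → Ω → ℝ) (P : Measure Ω) :
    Prop where
  measurable : ∀ t, Measurable (Z t)
  start : ∀ᵐ ω ∂P, Z 0 ω = 0
  indep : HasIndepIncrements Z P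
  stationary : ∀ s t : ℝ≥0, P.map (fun ω => Z (s + t) ω - Z s ω) = P.map (Z t)
  stochCont : ∀ t : ℝ≥0, TendstoInMeasure P Z (𝓝 t) (Z t)

/-- `μ` is a Lévy measure on the line: it does not charge `0` and `∫ (1 ∧ u²) μ(du) < ∞`. -/
structure IsLevyMeasure (μ : Measure ℝ) : Prop where
  zero : μ {0} = 0
  lintegral_lt_top : ∫⁻ u, ENNReal.ofReal (min 1 (u ^ 2)) ∂μ < ∞

/-- The characteristic exponent
`ψ(ξ) = i a ξ + ∫ (1 - e^{iξu} + iξu 1_{|u|<1}) μ(du)` (no Gaussian component). -/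
def levyExponent (a : ℝ) (μ : Measure ℝ) (ξ : ℝ) : ℂ :=
  Complex.I * a * ξ +
    ∫ u, (1 - Complex.exp (Complex.I * ξ * u) +
      Set.indicator {v : ℝ | |v| < 1} (fun v : ℝ => Complex.I * ξ * v) u) ∂μ

/-- `ψ^L(ξ) = ∫_{|ξu|<1} (ξu)² μ(du)`. -/
def psiL (μ : Measure ℝ) (ξ : ℝ) : ℝ := ∫ u in {u : ℝ | |ξ * u| < 1}, (ξ * u) ^ 2 ∂μ

/-- `ψ^U(ξ) = ∫ ((ξu)² ∧ 1) μ(du)`. -/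
def psiU (μ : Measure ℝ) (ξ : ℝ) : ℝ := ∫ u, min ((ξ * u) ^ 2) 1 ∂μ

/-- Condition **A**. -/
def ConditionA (μ : Measure ℝ) : Prop := ∃ β : ℝ, 1 < β ∧ ∀ ξ : ℝ, psiU μ ξ ≤ β * psiL μ ξ

/-- `ρ_t = inf {ξ > 0 : Re ψ(ξ) ≥ 1/t}`. -/
def rho (a : ℝ) (μ : Measure ℝ) (t : ℝ) : ℝ :=
  sInf {ξ : ℝ | 0 < ξ ∧ 1 / t ≤ (levyExponent a μ ξ).re}

/-- `ψ_t(ξ) = t ∫_{|ρ_t u| ≤ 1} (1 - e^{iξu} + iξu) μ(du)`, the exponent of the small-jump part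
`Z̄_t` at time `t`. -/
def truncExponent (a : ℝ) (μ : Measure ℝ) (t ξ : ℝ) : ℂ :=
  t * ∫ u in {u : ℝ | |rho a μ t * u| ≤ 1},
    (1 - Complex.exp (Complex.I * ξ * u) + Complex.I * ξ * u) ∂μ

/-- `Λ_t(du) = t 1_{|ρ_t u| > 1} μ(du)`. -/
def bigJump (a : ℝ) (μ : Measure ℝ) (t : ℝ) : Measure ℝ :=
  ENNReal.ofReal t • μ.restrict {u : ℝ | 1 < |rho a μ t * u|}

/-- `a_t = t (a + ∫ u (1_{|u|<1} - 1_{|ρ_t u| ≤ 1}) μ(du))`. If `ρ_t > 1`, the integral is the one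
of `u` over `1/ρ_t < |u| < 1`; if `ρ_t ≤ 1`, it is minus the one over `1 ≤ |u| ≤ 1/ρ_t`.
In all cases `t ψ(ξ) = ψ_t(ξ) + ∫ (1 - e^{iξu}) Λ_t(du) + i ξ a_t`,
i.e. `Z_t = Z̄_t + Ẑ_t - a_t` in law. -/
def shift (a : ℝ) (μ : Measure ℝ) (t : ℝ) : ℝ :=
  t * (a + ∫ u, (Set.indicator {v : ℝ | |v| < 1} (fun v => v) u -
    Set.indicator {v : ℝ | |rho a μ t * v| ≤ 1} (fun v => v) u) ∂μ)

/-- `p` is the (unique) continuous distribution density of the law `ν`. -/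
structure IsContDensity (ν : Measure ℝ) (p : ℝ → ℝ) : Prop where
  continuous : Continuous p
  nonneg : ∀ x, 0 ≤ p x
  eq_withDensity : ν = (volume : Measure ℝ).withDensity (fun x => ENNReal.ofReal (p x))

/-- The `m`-fold convolution power `Q^{*m}`, with `Q^{*0} = δ_0`. -/
def convPow (Q : Measure ℝ) : ℕ → Measure ℝ
  | 0 => Measure.dirac 0
  | m + 1 => (convPow Q m).conv Q

/-- The `m`-th term `(1/m!) ∫ σ h((x-y)ζ) Q^{*m}(dy)` of a compound kernel. -/
def compoundTerm (σ : ℝ) (h : ℝ → ℝ) (ζ : ℝ) (Q : Measure ℝ) (x : ℝ) (m : ℕ) : ℝ :=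
  1 / (m.factorial : ℝ) * ∫ y, σ * h ((x - y) * ζ) ∂(convPow Q m)

/-- The compound kernel is a genuine (finite) quantity at `x`: `Q` is a finite measure, all the
integrals exist and the series converges. -/
structure CompoundWellDefined (σ : ℝ) (h : ℝ → ℝ) (ζ : ℝ) (Q : Measure ℝ) (x : ℝ) : Prop where
  finite : IsFiniteMeasure Q
  integrable : ∀ m, Integrable (fun y => σ * h ((x - y) * ζ)) (convPow Q m)
  summable : Summable (compoundTerm σ h ζ Q x)

/-- `g`, considered on `A ⊆ (0,∞) × ℝ`, satisfies the upper compound kernel estimate with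
parameters `(σ_t, h, ζ_t, Q_t)`. -/
def UpperCompoundKernelEstimate (A : Set (ℝ × ℝ)) (g : ℝ → ℝ → ℝ)
    (σ : ℝ → ℝ) (h : ℝ → ℝ) (ζ : ℝ → ℝ) (Q : ℝ → Measure ℝ) : Prop :=
  ∀ t x : ℝ, (t, x) ∈ A → CompoundWellDefined (σ t) h (ζ t) (Q t) x ∧
    g t x ≤ ∑' m, compoundTerm (σ t) h (ζ t) (Q t) x m

/-- `g`, considered on `A ⊆ (0,∞) × ℝ`, satisfies the lower compound kernel estimate with
parameters `(σ_t, h, ζ_t, Q_t)`. -/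
def LowerCompoundKernelEstimate (A : Set (ℝ × ℝ)) (g : ℝ → ℝ → ℝ)
    (σ : ℝ → ℝ) (h : ℝ → ℝ) (ζ : ℝ → ℝ) (Q : ℝ → Measure ℝ) : Prop :=
  ∀ t x : ℝ, (t, x) ∈ A → CompoundWellDefined (σ t) h (ζ t) (Q t) x ∧
    ∑' m, compoundTerm (σ t) h (ζ t) (Q t) x m ≤ g t x

/-- `f_upper(x) = b₁ e^{-b₂|x|}`. -/
def fUpper (b₁ b₂ : ℝ) (x : ℝ) : ℝ := b₁ * Real.exp (-b₂ * |x|)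

/-- `f_lower(x) = b₃ 1_{|x| ≤ b₄}`. -/
def fLower (b₃ b₄ : ℝ) (x : ℝ) : ℝ := b₃ * Set.indicator {z : ℝ | |z| ≤ b₄} (fun _ => 1) x

end LevyKernel

end

namespace LevyKernel

/-! At time `t` the jumps are cut at size `1/ρ_t`. The splitting `mul_levyExponent_eq` shows that
`Z_t` is in law an independent sum of a centred small-jump variable, a compound Poisson variable
with jump measure `Λ_t`, and the drift `-a_t`. Hence `p_t(x - a_t) = e^{-Λ_t(ℝ)} ∑ (1/m!) ∫ p̄_t(x -
y) Λ_t^{*m}(dy)`. Both estimates follow by comparing terms, once `Λ_t(ℝ)` is bounded in `t` and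
`p̄_t`, rescaled by `ρ_t`, has exponential decay and a lower bound near its first mode, uniformly in
`t`.

Condition A makes `ψ^U` grow geometrically under doubling: `ψ^U(ξ) ≤ r ψ^U(2ξ)` with `r = 1 - 3/(4β)
< 1` (`psiU_le_pow_mul`). This gives `ρ_t > 0`. Together with the choice of `ρ_t` it makes `t
ψ^U(ρ_t)` comparable to `1`, and makes the real part of the rescaled small-jump exponent at least
`c|ξ|^α` for `|ξ| ≥ 1`, with `c, α` depending on `β` only (`growth_small_jumps`).

The uniform estimates are in `exists_uniform_density_bounds`. Tilting the small-jump law by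
`e^{lx}`, `|l| ≤ 1`, damages the decay of the characteristic function only by a constant factor in
the exponent, so tilted densities are uniformly bounded; undoing the tilts `l = ±1` gives `q(x) ≤ b
e^{-|x|}`. Unit mass and this decay force the maximum of `q` to be bounded below, and a uniform
Lipschitz bound extends this to a neighbourhood of the mode. -/

/-! ### Weak limits through characteristic functions. -/

/-- **Lévy's continuity theorem**: a pointwise limit of characteristic functions of probability
measures which is continuous at `0` is itself the characteristic function of a probability
measure. -/
theorem exists_charFun_eq_of_tendsto {m : ℕ → Measure ℝ} [∀ n, IsProbabilityMeasure (m n)]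
    {χ : ℝ → ℂ} (hχ : ContinuousAt χ 0)
    (h : ∀ ξ, Tendsto (fun n => charFun (m n) ξ) atTop (𝓝 (χ ξ))) :
    ∃ ν : Measure ℝ, IsProbabilityMeasure ν ∧ ∀ ξ, charFun ν ξ = χ ξ := by
  have ht := isTightMeasureSet_of_tendsto_charFun hχ h
  let M : ℕ → ProbabilityMeasure ℝ := fun n => ⟨m n, inferInstance⟩
  -- Continuity of the limit at `0` gives tightness. By Prokhorov's theorem the sequence then has a
  -- cluster point, and its characteristic function must be the limit.
  have hc : IsCompact (closure (Set.range M)) := by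
    apply isCompact_closure_of_isTightMeasureSet
    convert ht using 1
    ext ν
    simp only [Set.mem_ofPred_eq, Set.mem_range, M]
    constructor
    · rintro ⟨_, ⟨n, rfl⟩, rfl⟩
      exact ⟨n, rfl⟩
    · rintro ⟨n, rfl⟩
      exact ⟨_, ⟨n, rfl⟩, rfl⟩
  obtain ⟨ν, -, hν⟩ := hc.exists_mapClusterPt (f := atTop) (u := M)
    (le_principal_iff.2 (mem_map.2 (univ_mem' fun n => subset_closure ⟨n, rfl⟩)))
  refine ⟨ν, inferInstance, fun ξ => ?_⟩
  have hcont : Continuous fun ν : ProbabilityMeasure ℝ => charFun (ν : Measure ℝ) ξ := by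
    simp_rw [charFun_eq_integral_innerProbChar]
    rw [continuous_iff_continuousAt]
    intro ν₀
    exact (ProbabilityMeasure.tendsto_iff_forall_integral_rclike_tendsto ℂ).1 tendsto_id
      (BoundedContinuousFunction.innerProbChar ξ)
  have h1 : MapClusterPt (charFun (ν : Measure ℝ) ξ) atTop (fun n => charFun (m n) ξ) :=
    hν.continuousAt_comp hcont.continuousAt
  exact eq_of_nhds_neBot (h1.neBot.mono (inf_le_inf_left _ (h ξ)))

/-! ### Fourier inversion for laws with integrable characteristic function. -/

/-- The candidate for the density of the law with characteristic function `χ`. -/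
noncomputable def fourierDensity (χ : ℝ → ℂ) (x : ℝ) : ℝ :=
  (FourierTransform.fourier (fun v : ℝ => χ (2 * Real.pi * v)) x).re

/-- The dilation by `2π` passes from the kernel `e^{-2πivx}` of the Fourier transform to the
convention of characteristic functions; it absorbs the factor `1/(2π)` of the inversion formula. -/
theorem integrable_comp_two_pi {E : Type*} [NormedAddCommGroup E] {χ : ℝ → E}
    (hχ : Integrable χ) : Integrable (fun v : ℝ => χ (2 * Real.pi * v)) :=
  hχ.comp_mul_left' (by positivity)

theorem continuous_fourier {f : ℝ → ℂ} (hf : Integrable f) :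
    Continuous (FourierTransform.fourier f : ℝ → ℂ) :=
  VectorFourier.fourierIntegral_continuous Real.continuous_fourierChar
    (by simp only [innerₗ_apply_apply]; exact continuous_inner) hf

theorem continuous_fourierDensity {χ : ℝ → ℂ} (hχ : Integrable χ) :
    Continuous (fourierDensity χ) :=
  Complex.continuous_re.comp (continuous_fourier (integrable_comp_two_pi hχ))

theorem fourierDensity_le {χ : ℝ → ℂ} {B : ℝ → ℝ} (hB : Integrable B)
    (h : ∀ ξ, ‖χ ξ‖ ≤ B ξ) (x : ℝ) :
    fourierDensity χ x ≤ ∫ v, B (2 * Real.pi * v) := by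
  refine (Complex.re_le_norm _).trans ?_
  rw [Real.fourier_eq']
  refine norm_integral_le_of_norm_le (integrable_comp_two_pi hB) (ae_of_all _ fun v => ?_)
  rw [norm_smul, Complex.norm_exp_ofReal_mul_I, one_mul]
  exact h _

theorem abs_fourierDensity_sub_le {χ : ℝ → ℂ} (hχ : Integrable χ) {B : ℝ → ℝ}
    (hB : Integrable fun ξ => |ξ| * B ξ) (h : ∀ ξ, ‖χ ξ‖ ≤ B ξ) (x y : ℝ) :
    |fourierDensity χ x - fourierDensity χ y| ≤
      (∫ v, |2 * Real.pi * v| * B (2 * Real.pi * v)) * |x - y| := by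
  rw [fourierDensity, fourierDensity, ← Complex.sub_re]
  refine (Complex.abs_re_le_norm _).trans ?_
  have hi : ∀ x : ℝ, Integrable fun v : ℝ =>
      Complex.exp (↑(-2 * Real.pi * inner ℝ v x) * Complex.I) • χ (2 * Real.pi * v) := by
    intro x
    refine (integrable_comp_two_pi hχ).norm.mono' ?_ (ae_of_all _ fun v => ?_)
    · exact (by fun_prop : Continuous fun v : ℝ =>
        Complex.exp (↑(-2 * Real.pi * inner ℝ v x) * Complex.I)).aestronglyMeasurable.smul
        (integrable_comp_two_pi hχ).aestronglyMeasurable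
    · rw [norm_smul, Complex.norm_exp_ofReal_mul_I, one_mul]
  rw [Real.fourier_eq', Real.fourier_eq', ← integral_sub (hi x) (hi y), ← integral_mul_const]
  refine norm_integral_le_of_norm_le
    ((integrable_comp_two_pi hB).mul_const _) (ae_of_all _ fun v => ?_)
  rw [← sub_smul, norm_smul, mul_right_comm |2 * Real.pi * v|]
  refine mul_le_mul ?_ (h _) (norm_nonneg _) (mul_nonneg (abs_nonneg _) (abs_nonneg _))
  have h1 : Complex.exp (↑(-2 * Real.pi * inner ℝ v x) * Complex.I)
      - Complex.exp (↑(-2 * Real.pi * inner ℝ v y) * Complex.I)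
      = Complex.exp (↑(-2 * Real.pi * inner ℝ v y) * Complex.I) *
        (Complex.exp (Complex.I * ↑(-2 * Real.pi * v * (x - y))) - 1) := by
    rw [mul_sub, ← Complex.exp_add, mul_one]
    congr 2
    simp
    ring
  rw [h1, norm_mul, Complex.norm_exp_ofReal_mul_I, one_mul]
  refine (Real.norm_exp_I_mul_ofReal_sub_one_le).trans ?_
  rw [Real.norm_eq_abs, abs_mul, abs_mul, abs_mul, abs_mul, abs_mul, abs_neg]

theorem integrable_gaussian_charFun (ν : Measure ℝ) [IsProbabilityMeasure ν] {b : ℝ} (hb : 0 < b) :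
    Integrable fun v : ℝ => charFun ν (2 * Real.pi * v) * Complex.exp (-Real.pi * b * v ^ 2) := by
  have h := (integrable_cexp_neg_mul_sq (b := (Real.pi * b : ℝ))
    (by rw [Complex.ofReal_re]; positivity))
  refine h.norm.mono' ?_ (ae_of_all _ fun v => ?_)
  · exact ((measurable_charFun.comp (by fun_prop)).mul (by fun_prop)).aestronglyMeasurable
  · rw [norm_mul]
    refine (mul_le_of_le_one_left (norm_nonneg _) (norm_charFun_le_one _)).trans_eq ?_
    congr 2
    push_cast; ring

/-- Gaussian regularisation of the inversion formula. -/
theorem fourier_gaussian_charFun (ν : Measure ℝ) [IsProbabilityMeasure ν] {b : ℝ} (hb : 0 < b)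
    (x : ℝ) :
    FourierTransform.fourier
      (fun v : ℝ => charFun ν (2 * Real.pi * v) * Complex.exp (-Real.pi * b * v ^ 2)) x =
    ((∫ y, 1 / Real.sqrt b * Real.exp (-(Real.pi / b) * (x - y) ^ 2) ∂ν : ℝ) : ℂ) := by
  rw [Real.fourier_eq']
  have h1 : ∀ v : ℝ, Complex.exp (↑(-2 * Real.pi * inner ℝ v x) * Complex.I) •
      (charFun ν (2 * Real.pi * v) * Complex.exp (-Real.pi * b * v ^ 2)) =
      ∫ y, Complex.exp (↑(-2 * Real.pi * inner ℝ v (x - y)) * Complex.I) *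
        Complex.exp (-Real.pi * b * v ^ 2) ∂ν := by
    intro v
    rw [integral_mul_const, smul_eq_mul, ← mul_assoc, charFun_apply_real, ← integral_const_mul]
    congr 2
    ext y
    rw [← Complex.exp_add]
    congr 1
    simp
    ring
  simp_rw [h1]
  rw [integral_integral_swap, ← integral_complex_ofReal]
  · congr 1
    ext y
    have h2 := congrFun (fourier_gaussian_pi (b := (b : ℂ)) (by simpa using hb)) (x - y)
    rw [Real.fourier_eq'] at h2
    simp_rw [smul_eq_mul] at h2
    rw [h2]
    push_cast
    congr 1
    · rw [Real.sqrt_eq_rpow, Complex.ofReal_cpow hb.le]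
      norm_num
    · congr 1; ring
  · have h3 : Integrable (fun v : ℝ => Complex.exp (-(Real.pi * b : ℝ) * v ^ 2)) :=
      integrable_cexp_neg_mul_sq (b := (Real.pi * b : ℝ)) (by rw [Complex.ofReal_re]; positivity)
    have h4 := h3.norm.mul_prod (integrable_const (1 : ℝ) (μ := ν))
    refine h4.mono' (by fun_prop) (ae_of_all _ fun p => ?_)
    simp only [Function.uncurry]
    rw [norm_mul, Complex.norm_exp_ofReal_mul_I, one_mul, mul_one]
    apply le_of_eq
    congr 2
    push_cast; ring

theorem tendsto_fourier_gaussian_charFun (ν : Measure ℝ) [IsProbabilityMeasure ν]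
    (hν : Integrable (charFun ν)) (x : ℝ) :
    Tendsto (fun n : ℕ => FourierTransform.fourier (fun v : ℝ => charFun ν (2 * Real.pi * v) *
        Complex.exp (-Real.pi * (1 / ((n : ℝ) + 1) : ℝ) * v ^ 2)) x) atTop
      (𝓝 (FourierTransform.fourier (fun v : ℝ => charFun ν (2 * Real.pi * v)) x)) := by
  simp_rw [Real.fourier_eq']
  refine tendsto_integral_of_dominated_convergence (fun v => ‖charFun ν (2 * Real.pi * v)‖)
    (fun n => ?_) (integrable_comp_two_pi hν).norm (fun n => ae_of_all _ fun v => ?_)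
    (ae_of_all _ fun v => ?_)
  · refine (by fun_prop : Continuous fun v : ℝ =>
        Complex.exp (↑(-2 * Real.pi * inner ℝ v x) * Complex.I)).aestronglyMeasurable.smul
      (integrable_gaussian_charFun ν (by positivity)).aestronglyMeasurable
  · rw [norm_smul, Complex.norm_exp_ofReal_mul_I, one_mul, norm_mul]
    refine mul_le_of_le_one_right (norm_nonneg _) ?_
    have : (-Real.pi * (1 / ((n : ℝ) + 1) : ℝ) * v ^ 2 : ℂ) =
        ((-Real.pi * (1 / ((n : ℝ) + 1)) * v ^ 2 : ℝ) : ℂ) := by push_cast; ring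
    rw [this, Complex.norm_exp_ofReal, Real.exp_le_one_iff, neg_mul, neg_mul, neg_nonpos]
    positivity
  · refine Tendsto.const_smul ?_ _
    have h : Tendsto (fun n : ℕ => Complex.exp (-Real.pi * (1 / ((n : ℝ) + 1) : ℝ) * v ^ 2))
        atTop (𝓝 (Complex.exp (-Real.pi * (0 : ℝ) * v ^ 2))) := by
      have := tendsto_one_div_add_atTop_nhds_zero_nat (𝕜 := ℝ)
      refine (Complex.continuous_exp.tendsto _).comp ?_
      exact ((tendsto_const_nhds.mul ((Complex.continuous_ofReal.tendsto _).comp this)).mul_const _)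
    simpa using h.const_mul (charFun ν (2 * Real.pi * v))

/-- The Gaussian regularisations are densities of `ν` convolved with a Gaussian, so they are real
and nonnegative; both properties survive the limit. -/
theorem fourier_charFun_eq (ν : Measure ℝ) [IsProbabilityMeasure ν]
    (hν : Integrable (charFun ν)) (x : ℝ) :
    0 ≤ fourierDensity (charFun ν) x ∧
      FourierTransform.fourier (fun v : ℝ => charFun ν (2 * Real.pi * v)) x =
        (fourierDensity (charFun ν) x : ℂ) := by
  have h := tendsto_fourier_gaussian_charFun ν hν x
  simp_rw [fourier_gaussian_charFun ν (Nat.one_div_pos_of_nat (α := ℝ))] at h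
  constructor
  · refine ge_of_tendsto ((Complex.continuous_re.tendsto _).comp h) (Eventually.of_forall fun n => ?_)
    simp only [Function.comp, Complex.ofReal_re]
    exact integral_nonneg fun y => by positivity
  · apply Complex.ext
    · simp [fourierDensity]
    · refine tendsto_nhds_unique ((Complex.continuous_im.tendsto _).comp h) ?_
      simp [Function.comp_def]

theorem lintegral_integral_gaussian (ν : Measure ℝ) [IsProbabilityMeasure ν] {b : ℝ} (hb : 0 < b) :
    ∫⁻ x, ENNReal.ofReal (∫ y, 1 / Real.sqrt b * Real.exp (-(Real.pi / b) * (x - y) ^ 2) ∂ν) = 1 := by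
  have h1 : ∀ x : ℝ,
      ENNReal.ofReal (∫ y, 1 / Real.sqrt b * Real.exp (-(Real.pi / b) * (x - y) ^ 2) ∂ν) =
      ∫⁻ y, ENNReal.ofReal (1 / Real.sqrt b * Real.exp (-(Real.pi / b) * (x - y) ^ 2)) ∂ν := by
    intro x
    refine ofReal_integral_eq_lintegral_ofReal ?_ (ae_of_all _ fun y => by positivity)
    refine Integrable.const_mul ((integrable_const (1 : ℝ)).mono' (by fun_prop)
      (ae_of_all _ fun y => ?_)) _
    rw [Real.norm_eq_abs, Real.abs_exp, Real.exp_le_one_iff, neg_mul, neg_nonpos]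
    positivity
  simp_rw [h1]
  rw [lintegral_lintegral_swap (by fun_prop)]
  have h2 : ∀ y : ℝ,
      ∫⁻ x, ENNReal.ofReal (1 / Real.sqrt b * Real.exp (-(Real.pi / b) * (x - y) ^ 2)) = 1 := by
    intro y
    rw [lintegral_sub_right_eq_self
      (fun x => ENNReal.ofReal (1 / Real.sqrt b * Real.exp (-(Real.pi / b) * x ^ 2))) y,
      ← ofReal_integral_eq_lintegral_ofReal
        ((integrable_exp_neg_mul_sq (by positivity)).const_mul _)
        (ae_of_all _ fun y => by positivity), integral_const_mul, integral_gaussian]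
    have : Real.pi / (Real.pi / b) = b := by field_simp
    rw [this, one_div, inv_mul_cancel₀ (by positivity)]
    simp
  simp_rw [h2]
  simp

/-- A probability law with integrable characteristic function has a continuous density, given by
the inversion formula. -/
theorem isContDensity_fourierDensity (ν : Measure ℝ) [IsProbabilityMeasure ν]
    (hν : Integrable (charFun ν)) : IsContDensity ν (fourierDensity (charFun ν)) := by
  set q := fourierDensity (charFun ν) with hq
  have hc : Continuous q := continuous_fourierDensity hν
  have h0 : ∀ x, 0 ≤ q x := fun x => (fourier_charFun_eq ν hν x).1
  -- Fatou's lemma along the Gaussian regularisations, each of mass `1`. Only the inequality is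
  -- needed: it makes `q` integrable, so that Fourier inversion applies to `charFun ν` and
  -- identifies the law.
  have hle : ∫⁻ x, ENNReal.ofReal (q x) ≤ 1 := by
    have hlim : ∀ x, liminf (fun n : ℕ => ENNReal.ofReal
        (∫ y, 1 / Real.sqrt (1 / ((n : ℝ) + 1)) *
          Real.exp (-(Real.pi / (1 / ((n : ℝ) + 1))) * (x - y) ^ 2) ∂ν)) atTop =
        ENNReal.ofReal (q x) := by
      intro x
      have h := tendsto_fourier_gaussian_charFun ν hν x
      simp_rw [fourier_gaussian_charFun ν (Nat.one_div_pos_of_nat (α := ℝ))] at h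
      refine Tendsto.liminf_eq ((ENNReal.continuous_ofReal.tendsto _).comp ?_)
      exact (Complex.continuous_re.tendsto _).comp h
    simp_rw [← hlim]
    refine (lintegral_liminf_le fun n => ?_).trans ?_
    · refine ENNReal.measurable_ofReal.comp ?_
      exact (StronglyMeasurable.integral_prod_right (by fun_prop)).measurable
    · simp_rw [lintegral_integral_gaussian ν (Nat.one_div_pos_of_nat (α := ℝ))]
      simp
  have hint : Integrable q := by
    refine ⟨hc.aestronglyMeasurable, ?_⟩
    rw [hasFiniteIntegral_iff_ofReal (ae_of_all _ h0)]
    exact hle.trans_lt ENNReal.one_lt_top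
  have hfin : IsFiniteMeasure ((volume : Measure ℝ).withDensity fun x => ENNReal.ofReal (q x)) :=
    isFiniteMeasure_withDensity (hle.trans_lt ENNReal.one_lt_top).ne
  refine ⟨hc, h0, Measure.ext_of_charFun ?_⟩
  ext ξ
  have hF : FourierTransform.fourier (fun v : ℝ => charFun ν (2 * Real.pi * v)) =
      fun x : ℝ => (q x : ℂ) := funext fun x => (fourier_charFun_eq ν hν x).2
  have hinv := congrFun (Continuous.fourierInv_fourier_eq
    (f := fun v : ℝ => charFun ν (2 * Real.pi * v))
    ((continuous_charFun (μ := ν)).comp (by fun_prop)) (integrable_comp_two_pi hν)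
    (by rw [hF]; exact hint.ofReal)) (ξ / (2 * Real.pi))
  rw [hF, Real.fourierInv_eq'] at hinv
  have h2 : 2 * Real.pi * (ξ / (2 * Real.pi)) = ξ := by field_simp
  simp only [h2] at hinv
  rw [← hinv, charFun_apply_real, integral_withDensity_eq_integral_toReal_smul
    (by fun_prop) (by simp)]
  congr 1
  ext x
  rw [ENNReal.toReal_ofReal (h0 x), Complex.real_smul, smul_eq_mul, mul_comm]
  congr 3
  rw [← Complex.ofReal_mul]
  congr 1
  simp
  field_simp

/-! ### Compound Poisson laws and convolution with a density. -/

/-- The compound Poisson law `e^{-Q(ℝ)} ∑ₘ Q^{*m} / m!`. -/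
noncomputable def compoundPoisson (Q : Measure ℝ) : Measure ℝ :=
  Measure.sum fun m : ℕ =>
    ENNReal.ofReal (Real.exp (-Q.real Set.univ) / m.factorial) • convPow Q m

theorem integrable_compoundPoisson {Q : Measure ℝ} {E : Type*} [NormedAddCommGroup E] {f : ℝ → E}
    (hf : ∀ m, Integrable f (convPow Q m)) {C A : ℝ}
    (h : ∀ m, ∫ x, ‖f x‖ ∂(convPow Q m) ≤ C * A ^ m) :
    Integrable f (compoundPoisson Q) := by
  unfold compoundPoisson
  refine integrable_sum_measure (fun m => (hf m).smul_measure ENNReal.ofReal_ne_top) ?_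
  refine Summable.of_nonneg_of_le (fun m => integral_nonneg fun x => norm_nonneg _) (fun m => ?_)
    ((Real.summable_pow_div_factorial A).mul_left (C * Real.exp (-Q.real Set.univ)))
  rw [integral_smul_measure, ENNReal.toReal_ofReal (by positivity), smul_eq_mul]
  calc _ ≤ Real.exp (-Q.real Set.univ) / m.factorial * (C * A ^ m) :=
        mul_le_mul_of_nonneg_left (h m) (by positivity)
    _ = _ := by ring

theorem hasSum_integral_compoundPoisson {Q : Measure ℝ} {E : Type*} [NormedAddCommGroup E] [NormedSpace ℝ E]
    {f : ℝ → E} (hf : Integrable f (compoundPoisson Q)) :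
    HasSum (fun m : ℕ => (Real.exp (-Q.real Set.univ) / m.factorial) • ∫ x, f x ∂(convPow Q m))
      (∫ x, f x ∂(compoundPoisson Q)) := by
  have h := hasSum_integral_measure hf
  refine h.congr_fun fun m => ?_
  rw [integral_smul_measure, ENNReal.toReal_ofReal (by positivity)]

section

variable (Q : Measure ℝ) [IsFiniteMeasure Q]

instance isFiniteMeasure_convPow (m : ℕ) : IsFiniteMeasure (convPow Q m) := by
  induction m with
  | zero => unfold convPow; infer_instance
  | succ m ih => unfold convPow; infer_instance

variable {Q}

/-- Exponentials turn convolution into multiplication. A complex `z` covers at once characteristic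
functions, exponential moments and, at `z = 0`, the total mass. -/
theorem integrable_cexp_convPow {z : ℂ} (h : Integrable (fun v : ℝ => Complex.exp (z * v)) Q)
    (m : ℕ) : Integrable (fun x : ℝ => Complex.exp (z * x)) (convPow Q m) ∧
      ∫ x : ℝ, Complex.exp (z * x) ∂(convPow Q m) = (∫ v : ℝ, Complex.exp (z * v) ∂Q) ^ m := by
  induction m with
  | zero =>
    unfold convPow
    refine ⟨integrable_dirac (by simp), ?_⟩
    rw [integral_dirac]; simp
  | succ m ih =>
    have hint : Integrable (fun x : ℝ => Complex.exp (z * x)) ((convPow Q m).conv Q) := by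
      rw [integrable_conv_iff (by fun_prop)]
      have hadd : ∀ x y : ℝ, Complex.exp (z * (x + y : ℝ)) =
          Complex.exp (z * x) * Complex.exp (z * y) := by
        intro x y; rw [← Complex.exp_add]; push_cast; ring_nf
      simp_rw [hadd, norm_mul, integral_const_mul]
      exact ⟨ae_of_all _ fun x => h.const_mul _, ih.1.norm.mul_const _⟩
    unfold convPow
    refine ⟨hint, ?_⟩
    rw [integral_conv hint, pow_succ, ← ih.2, ← integral_mul_const]
    congr 1
    ext x
    rw [← integral_const_mul]
    congr 1
    ext y
    rw [← Complex.exp_add]; push_cast; ring_nf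

theorem integrable_cexp_zero_mul (ν : Measure ℝ) [IsFiniteMeasure ν] :
    Integrable (fun v : ℝ => Complex.exp (0 * v)) ν := by
  simp

theorem measureReal_convPow (m : ℕ) : (convPow Q m).real Set.univ = Q.real Set.univ ^ m := by
  have h := (integrable_cexp_convPow (integrable_cexp_zero_mul Q) m).2
  simp at h
  exact_mod_cast h

theorem integrable_cexp_compoundPoisson {z : ℂ}
    (h : Integrable (fun v : ℝ => Complex.exp (z * v)) Q) :
    Integrable (fun x : ℝ => Complex.exp (z * x)) (compoundPoisson Q) := by
  refine integrable_compoundPoisson (C := 1) (A := ∫ v : ℝ, Real.exp (z.re * v) ∂Q)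
    (fun m => (integrable_cexp_convPow h m).1) fun m => ?_
  have h2 : Integrable (fun v : ℝ => Complex.exp (z.re * v)) Q := by
    refine h.norm.mono' (by fun_prop) (ae_of_all _ fun v => ?_)
    simp [Complex.norm_exp]
  have h3 := (integrable_cexp_convPow h2 m).2
  have h4 : ∀ v : ℝ, Complex.exp (z.re * v) = (Real.exp (z.re * v) : ℂ) := by
    intro v; push_cast; rfl
  simp_rw [h4] at h3
  rw [integral_complex_ofReal, integral_complex_ofReal] at h3
  rw [one_mul]
  apply le_of_eq
  simp only [Complex.norm_exp, Complex.mul_re, Complex.ofReal_re, Complex.ofReal_im, mul_zero,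
    sub_zero]
  exact_mod_cast h3

/-- The (complex) moment generating function of a compound Poisson law. -/
theorem integral_cexp_compoundPoisson {z : ℂ}
    (h : Integrable (fun v : ℝ => Complex.exp (z * v)) Q) :
    ∫ x : ℝ, Complex.exp (z * x) ∂(compoundPoisson Q) =
      Complex.exp (∫ v : ℝ, (Complex.exp (z * v) - 1) ∂Q) := by
  have h1 := hasSum_integral_compoundPoisson (integrable_cexp_compoundPoisson h)
  refine h1.unique ?_
  rw [integral_sub h (integrable_const _)]
  simp only [integral_const, Complex.real_smul, mul_one]
  rw [sub_eq_add_neg, add_comm, Complex.exp_add]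
  have h2 := (NormedSpace.expSeries_div_hasSum_exp (∫ v : ℝ, Complex.exp (z * v) ∂Q)).mul_left
    (Complex.exp (-(Q.real Set.univ : ℂ)))
  rw [← Complex.exp_eq_exp_ℂ] at h2
  refine h2.congr_fun fun m => ?_
  rw [(integrable_cexp_convPow h m).2]
  push_cast
  ring

variable (Q) in
instance isProbabilityMeasure_compoundPoisson : IsProbabilityMeasure (compoundPoisson Q) := by
  have h0 := integrable_cexp_compoundPoisson (integrable_cexp_zero_mul Q)
  have h := integral_cexp_compoundPoisson (integrable_cexp_zero_mul Q)
  simp only [zero_mul, Complex.exp_zero, sub_self, integral_zero] at h h0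
  have : IsFiniteMeasure (compoundPoisson Q) := by
    rwa [integrable_const_iff_isFiniteMeasure one_ne_zero] at h0
  rw [isProbabilityMeasure_iff_real]
  simpa using h

theorem charFun_compoundPoisson (ξ : ℝ) :
    charFun (compoundPoisson Q) ξ =
      Complex.exp (∫ v : ℝ, (Complex.exp (Complex.I * ξ * v) - 1) ∂Q) := by
  rw [← integral_cexp_compoundPoisson, charFun_apply_real]
  · congr 1; ext x; congr 1; ring
  · refine (integrable_const (1 : ℝ)).mono' (by fun_prop) (ae_of_all _ fun v => ?_)
    simp [Complex.norm_exp]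

end

/-- Convolving a law having a bounded continuous density with an arbitrary law. -/
theorem IsContDensity.conv {ν D : Measure ℝ} [IsProbabilityMeasure D] {q : ℝ → ℝ}
    (hq : IsContDensity ν q) {B : ℝ} (hB : ∀ x, q x ≤ B) :
    IsContDensity (ν.conv D) (fun x => ∫ y, q (x - y) ∂D) := by
  have hc := hq.continuous
  refine ⟨?_, fun x => integral_nonneg fun y => hq.nonneg _, ?_⟩
  · refine continuous_of_dominated (bound := fun _ => B) (fun x => by fun_prop)
      (fun x => ae_of_all _ fun y => ?_) (integrable_const _) (ae_of_all _ fun y => by fun_prop)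
    rw [Real.norm_eq_abs, abs_of_nonneg (hq.nonneg _)]
    exact hB _
  · ext s hs
    have hi : ∀ x, ENNReal.ofReal (∫ y, q (x - y) ∂D) = ∫⁻ y, ENNReal.ofReal (q (x - y)) ∂D := by
      intro x
      refine ofReal_integral_eq_lintegral_ofReal ?_ (ae_of_all _ fun y => hq.nonneg _)
      refine (integrable_const B).mono' (by fun_prop) (ae_of_all _ fun y => ?_)
      rw [Real.norm_eq_abs, abs_of_nonneg (hq.nonneg _)]
      exact hB _
    have hfin : SFinite ν := by rw [hq.eq_withDensity]; infer_instance
    have hm : Measurable (fun x : ℝ => s.indicator (1 : ℝ → ℝ≥0∞) x) :=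
      measurable_one.indicator hs
    rw [← lintegral_indicator_one hs, Measure.lintegral_conv hm, withDensity_apply _ hs,
      ← lintegral_indicator hs, lintegral_lintegral_swap (by fun_prop)]
    simp_rw [hi]
    have h1 : ∀ x, s.indicator (fun x => ∫⁻ y, ENNReal.ofReal (q (x - y)) ∂D) x =
        ∫⁻ y, s.indicator 1 x * ENNReal.ofReal (q (x - y)) ∂D := by
      intro x
      by_cases hx : x ∈ s <;> simp [hx]
    simp_rw [h1]
    conv_rhs => rw [lintegral_lintegral_swap (by fun_prop)]
    refine lintegral_congr fun y => ?_
    rw [hq.eq_withDensity, lintegral_withDensity_eq_lintegral_mul _ (by fun_prop) (by fun_prop),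
      ← lintegral_add_right_eq_self (fun x => s.indicator 1 x * ENNReal.ofReal (q (x - y))) y]
    refine lintegral_congr fun x => ?_
    simp [mul_comm]

/-! ### Centred laws with small jumps and their exponential tilts. -/

/-- `ν` is a Lévy measure carried by `[-1, 1]`. -/
structure IsSmallJumpMeasure (ν : Measure ℝ) : Prop where
  abs_le : ∀ᵐ v ∂ν, |v| ≤ 1
  integrable_sq : Integrable (fun v : ℝ => v ^ 2) ν

/-- The cumulant generating function `∫ (e^{zv} - 1 - zv) ν(dv)` of the centred law with jump
measure `ν`. -/
noncomputable def cumulant (ν : Measure ℝ) (z : ℂ) : ℂ :=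
  ∫ v : ℝ, (Complex.exp (z * v) - 1 - z * v) ∂ν

/-- The law of the jumps of size more than `1 / (n + 1)`, compensated. -/
noncomputable def truncLaw (ν : Measure ℝ) (n : ℕ) : Measure ℝ :=
  (compoundPoisson (ν.restrict {v : ℝ | 1 / ((n : ℝ) + 1) < |v|})).map
    fun x => x + -∫ v in {v : ℝ | 1 / ((n : ℝ) + 1) < |v|}, v ∂ν

/-- The characteristic function of the exponentially tilted law. -/
noncomputable def tiltedChar (ν : Measure ℝ) (l ξ : ℝ) : ℂ :=
  Complex.exp (cumulant ν (l + ξ * Complex.I) - cumulant ν l)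

theorem norm_exp_sub_one_sub_le (w : ℂ) :
    ‖Complex.exp w - 1 - w‖ ≤ ‖w‖ ^ 2 * Real.exp ‖w‖ := by
  have h := Complex.norm_exp_sub_sum_le_norm_mul_exp w 2
  simpa [Finset.sum_range_succ, sub_sub] using h

theorem norm_cumulant_integrand_le (z : ℂ) {v : ℝ} (hv : |v| ≤ 1) :
    ‖Complex.exp (z * v) - 1 - z * v‖ ≤ ‖z‖ ^ 2 * Real.exp ‖z‖ * v ^ 2 := by
  refine (norm_exp_sub_one_sub_le _).trans ?_
  rw [norm_mul, Complex.norm_real, Real.norm_eq_abs, mul_pow, sq_abs, mul_right_comm]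
  gcongr
  exact mul_le_of_le_one_right (norm_nonneg _) hv

theorem measurableSet_lt_abs (r : ℝ) : MeasurableSet {v : ℝ | r < |v|} :=
  measurableSet_lt measurable_const (by fun_prop)

namespace IsSmallJumpMeasure

variable {ν : Measure ℝ} (hν : IsSmallJumpMeasure ν)

include hν

theorem restrict (s : Set ℝ) : IsSmallJumpMeasure (ν.restrict s) :=
  ⟨ae_restrict_of_ae hν.abs_le, hν.integrable_sq.restrict⟩

theorem integrable_cumulant (z : ℂ) :
    Integrable (fun v : ℝ => Complex.exp (z * v) - 1 - z * v) ν := by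
  refine (hν.integrable_sq.const_mul (‖z‖ ^ 2 * Real.exp ‖z‖)).mono' (by fun_prop) ?_
  filter_upwards [hν.abs_le] with v hv using norm_cumulant_integrand_le z hv

theorem continuous_cumulant : Continuous (cumulant ν) := by
  rw [continuous_iff_continuousAt]
  intro z
  refine continuousAt_of_dominated
    (bound := fun v : ℝ => (‖z‖ + 1) ^ 2 * Real.exp (‖z‖ + 1) * v ^ 2)
    (Eventually.of_forall fun w => by fun_prop) ?_
    (hν.integrable_sq.const_mul _) (ae_of_all _ fun v => by fun_prop)
  have h : ∀ᶠ w : ℂ in 𝓝 z, ‖w‖ < ‖z‖ + 1 :=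
    continuous_norm.continuousAt.eventually_lt continuousAt_const (by simp)
  filter_upwards [h] with w hw
  filter_upwards [hν.abs_le] with v hv
  refine (norm_cumulant_integrand_le w hv).trans ?_
  gcongr

theorem isFiniteMeasure_restrict (n : ℕ) :
    IsFiniteMeasure (ν.restrict {v : ℝ | 1 / ((n : ℝ) + 1) < |v|}) := by
  refine ⟨?_⟩
  rw [Measure.restrict_apply_univ]
  refine (measure_mono ?_).trans_lt (hν.integrable_sq.measure_norm_gt_lt_top
    (ε := (1 / ((n : ℝ) + 1)) ^ 2) (by positivity))
  intro v hv
  simp only [Set.mem_ofPred_eq, Real.norm_eq_abs, abs_pow] at hv ⊢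
  gcongr

theorem tendsto_cumulant_restrict (z : ℂ) :
    Tendsto (fun n : ℕ => cumulant (ν.restrict {v : ℝ | 1 / ((n : ℝ) + 1) < |v|}) z) atTop
      (𝓝 (cumulant ν z)) := by
  unfold cumulant
  simp_rw [← integral_indicator (measurableSet_lt_abs _)]
  refine tendsto_integral_of_dominated_convergence
    (fun v => ‖Complex.exp (z * v) - 1 - z * v‖) (fun n => ?_) (hν.integrable_cumulant z).norm
    (fun n => ae_of_all _ fun v => norm_indicator_le_norm_self _ _) (ae_of_all _ fun v => ?_)
  · exact (hν.integrable_cumulant z).aestronglyMeasurable.indicator (measurableSet_lt_abs _)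
  · refine tendsto_const_nhds.congr' ?_
    -- The truncations never reach `v = 0`, but the integrand vanishes there, so an atom at `0`
    -- would do no harm.
    rcases eq_or_ne v 0 with rfl | hv
    · refine Eventually.of_forall fun n => ?_
      simp [Set.indicator_apply]
    · have h := tendsto_one_div_add_atTop_nhds_zero_nat (𝕜 := ℝ)
      filter_upwards [h.eventually_lt_const (abs_pos.2 hv)] with n hn
      rw [Set.indicator_of_mem]
      exact hn

theorem integrable_cexp (z : ℂ) [IsFiniteMeasure ν] :
    Integrable (fun v : ℝ => Complex.exp (z * v)) ν := by
  refine (integrable_const (Real.exp ‖z‖)).mono' (by fun_prop) ?_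
  filter_upwards [hν.abs_le] with v hv
  refine (Complex.norm_exp_le_exp_norm _).trans (Real.exp_le_exp.2 ?_)
  rw [norm_mul, Complex.norm_real, Real.norm_eq_abs]
  exact mul_le_of_le_one_right (norm_nonneg _) hv

theorem isProbabilityMeasure_truncLaw (n : ℕ) : IsProbabilityMeasure (truncLaw ν n) := by
  have := hν.isFiniteMeasure_restrict n
  exact Measure.isProbabilityMeasure_map (by fun_prop)

theorem truncLaw_cexp (n : ℕ) (z : ℂ) :
    Integrable (fun x : ℝ => Complex.exp (z * x)) (truncLaw ν n) ∧
    ∫ x : ℝ, Complex.exp (z * x) ∂(truncLaw ν n) =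
      Complex.exp (cumulant (ν.restrict {v : ℝ | 1 / ((n : ℝ) + 1) < |v|}) z) := by
  have := hν.isFiniteMeasure_restrict n
  have hr := hν.restrict {v : ℝ | 1 / ((n : ℝ) + 1) < |v|}
  have hi := hr.integrable_cexp z
  have hx : Integrable (fun v : ℝ => v) (ν.restrict {v : ℝ | 1 / ((n : ℝ) + 1) < |v|}) := by
    refine (integrable_const (1 : ℝ)).mono' (by fun_prop) ?_
    filter_upwards [hr.abs_le] with v hv using hv
  unfold truncLaw
  set Q := ν.restrict {v : ℝ | 1 / ((n : ℝ) + 1) < |v|}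
  have hsplit : ∀ x c : ℝ, Complex.exp (z * (x + -c : ℝ)) =
      Complex.exp (-(z * c)) * Complex.exp (z * x) := by
    intro x c
    rw [← Complex.exp_add]; push_cast; ring_nf
  constructor
  · rw [integrable_map_measure (by fun_prop) (by fun_prop)]
    simp only [Function.comp_def, hsplit]
    exact (integrable_cexp_compoundPoisson hi).const_mul _
  · rw [integral_map (by fun_prop) (by fun_prop)]
    simp only [hsplit]
    rw [integral_const_mul, integral_cexp_compoundPoisson hi, ← Complex.exp_add]
    congr 1
    unfold cumulant
    have hi1 : Integrable (fun v : ℝ => Complex.exp (z * v) - 1) Q := hi.sub (integrable_const _)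
    have hx1 : Integrable (fun v : ℝ => z * (v : ℂ)) Q := hx.ofReal.const_mul z
    rw [integral_sub hi1 hx1, integral_const_mul, integral_complex_ofReal]
    ring

theorem truncLaw_exp (n : ℕ) (l : ℝ) :
    Integrable (fun x : ℝ => Real.exp (l * x)) (truncLaw ν n) ∧
    ((∫ x : ℝ, Real.exp (l * x) ∂(truncLaw ν n) : ℝ) : ℂ) =
      Complex.exp (cumulant (ν.restrict {v : ℝ | 1 / ((n : ℝ) + 1) < |v|}) l) := by
  have h := hν.truncLaw_cexp n l
  have h4 : ∀ v : ℝ, Complex.exp (l * v) = (Real.exp (l * v) : ℂ) := by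
    intro v; push_cast; rfl
  simp only [h4] at h
  rw [integral_complex_ofReal] at h
  exact ⟨by simpa only [RCLike.re_eq_complex_re, Complex.ofReal_re] using h.1.re, h.2⟩

theorem isProbabilityMeasure_tilted_truncLaw (n : ℕ) (l : ℝ) :
    IsProbabilityMeasure ((truncLaw ν n).tilted (fun x => l * x)) := by
  have := hν.isProbabilityMeasure_truncLaw n
  exact isProbabilityMeasure_tilted (hν.truncLaw_exp n l).1

theorem charFun_tilted_truncLaw (n : ℕ) (l ξ : ℝ) :
    charFun ((truncLaw ν n).tilted (fun x => l * x)) ξ =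
      tiltedChar (ν.restrict {v : ℝ | 1 / ((n : ℝ) + 1) < |v|}) l ξ := by
  rw [charFun_apply_real, integral_tilted, tiltedChar, Complex.exp_sub,
    ← (hν.truncLaw_exp n l).2, ← (hν.truncLaw_cexp n _).2, ← integral_div]
  congr 1
  ext x
  rw [Complex.real_smul, Complex.ofReal_div, div_mul_eq_mul_div, Complex.ofReal_exp,
    ← Complex.exp_add]
  congr 2
  push_cast
  ring

theorem tendsto_charFun_tilted_truncLaw (l ξ : ℝ) :
    Tendsto (fun n => charFun ((truncLaw ν n).tilted (fun x => l * x)) ξ) atTop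
      (𝓝 (tiltedChar ν l ξ)) := by
  simp_rw [hν.charFun_tilted_truncLaw]
  exact (Complex.continuous_exp.tendsto _).comp
    ((hν.tendsto_cumulant_restrict _).sub (hν.tendsto_cumulant_restrict _))

theorem continuous_tiltedChar (l : ℝ) : Continuous (tiltedChar ν l) := by
  have := hν.continuous_cumulant
  unfold tiltedChar
  fun_prop

/-- For the truncated laws, finite-activity compound Poisson laws up to a shift, tilting is
explicit. The continuity theorem carries the tilted laws to the limit. -/
theorem exists_charFun_eq_tiltedChar (l : ℝ) :
    ∃ m : Measure ℝ, IsProbabilityMeasure m ∧ charFun m = tiltedChar ν l := by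
  have := fun n => hν.isProbabilityMeasure_tilted_truncLaw n l
  obtain ⟨m, hm, h⟩ := exists_charFun_eq_of_tendsto (hν.continuous_tiltedChar l).continuousAt
    (hν.tendsto_charFun_tilted_truncLaw l)
  exact ⟨m, hm, funext h⟩

/-- Exponential tilting in the limit, tested against a compactly supported function. -/
theorem integral_tilt {l : ℝ} {m₀ m : Measure ℝ} [IsProbabilityMeasure m₀]
    [IsProbabilityMeasure m] (h₀ : charFun m₀ = tiltedChar ν 0) (h : charFun m = tiltedChar ν l)
    {g : ℝ → ℝ} (hg : Continuous g) (hs : HasCompactSupport g) :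
    ∫ x, Real.exp (l * x) * g x ∂m₀ = Real.exp (cumulant ν l).re * ∫ x, g x ∂m := by
  -- Weak convergence of the tilted truncations suffices: `e^{lx} g(x)` is bounded because `g` has
  -- compact support, so no exponential moment of the limit law has to be known.
  have weak : ∀ (k : ℝ) (m' : Measure ℝ) [IsProbabilityMeasure m'], charFun m' = tiltedChar ν k →
      ∀ f : ℝ → ℝ, Continuous f → HasCompactSupport f →
      Tendsto (fun n => ∫ x, f x ∂((truncLaw ν n).tilted (fun x => k * x))) atTop
        (𝓝 (∫ x, f x ∂m')) := by
    intro k m' _ hm' f hf hfs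
    obtain ⟨C, hC⟩ := hfs.exists_bound_of_continuous hf
    have := fun n => hν.isProbabilityMeasure_tilted_truncLaw n k
    let T : ℕ → ProbabilityMeasure ℝ :=
      fun n => ⟨(truncLaw ν n).tilted (fun x => k * x), inferInstance⟩
    let T' : ProbabilityMeasure ℝ := ⟨m', inferInstance⟩
    have ht : Tendsto T atTop (𝓝 T') := by
      refine ProbabilityMeasure.tendsto_of_tendsto_charFun fun ξ => ?_
      simp only [T, T', ProbabilityMeasure.coe_mk, hm']
      exact hν.tendsto_charFun_tilted_truncLaw k ξ
    exact ProbabilityMeasure.tendsto_iff_forall_integral_tendsto.1 ht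
      (BoundedContinuousFunction.ofNormedAddCommGroup f hf C hC)
  have hgl : HasCompactSupport fun x => Real.exp (l * x) * g x := hs.mul_left
  have h1 := weak 0 m₀ h₀ _ (by fun_prop) hgl
  have h2 := weak l m h g hg hs
  have h3 : Tendsto (fun n => ∫ x, Real.exp (l * x) ∂(truncLaw ν n)) atTop
      (𝓝 (Real.exp (cumulant ν l).re)) := by
    have h4 : Tendsto (fun n : ℕ => ‖Complex.exp
        (cumulant (ν.restrict {v : ℝ | 1 / ((n : ℝ) + 1) < |v|}) l)‖) atTop
        (𝓝 ‖Complex.exp (cumulant ν l)‖) :=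
      ((Complex.continuous_exp.norm).tendsto _).comp (hν.tendsto_cumulant_restrict l)
    rw [Complex.norm_exp] at h4
    refine h4.congr fun n => ?_
    rw [← (hν.truncLaw_exp n l).2, Complex.norm_real, Real.norm_eq_abs,
      abs_of_nonneg (integral_nonneg fun x => (Real.exp_pos _).le)]
  refine tendsto_nhds_unique h1 ((h3.mul h2).congr fun n => ?_)
  have := hν.isProbabilityMeasure_truncLaw n
  simp_rw [integral_tilted, smul_eq_mul]
  rw [← integral_const_mul]
  have hpos : 0 < ∫ x, Real.exp (l * x) ∂(truncLaw ν n) :=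
    integral_exp_pos (hν.truncLaw_exp n l).1
  congr 1
  ext x
  simp
  field_simp

theorem re_cumulant_le {l K : ℝ} (hl : |l| ≤ 1) (hK : ∫ v, v ^ 2 ∂ν ≤ K) :
    (cumulant ν l).re ≤ Real.exp 1 * K := by
  refine (Complex.re_le_norm _).trans ?_
  refine (norm_integral_le_of_norm_le (hν.integrable_sq.const_mul (Real.exp 1)) ?_).trans ?_
  · filter_upwards [hν.abs_le] with v hv
    refine (norm_cumulant_integrand_le _ hv).trans ?_
    rw [Complex.norm_real, Real.norm_eq_abs]
    gcongr
    calc |l| ^ 2 * Real.exp |l| ≤ 1 ^ 2 * Real.exp 1 := by gcongr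
      _ = Real.exp 1 := by ring
  · rw [integral_const_mul]
    gcongr

theorem integrable_one_sub_cos (ξ : ℝ) : Integrable (fun v => 1 - Real.cos (ξ * v)) ν := by
  refine (hν.integrable_sq.const_mul (ξ ^ 2 / 2)).mono' (by fun_prop) (ae_of_all _ fun v => ?_)
  rw [Real.norm_eq_abs, abs_of_nonneg (by linarith [Real.cos_le_one (ξ * v)])]
  have := Real.one_sub_sq_div_two_le_cos (x := ξ * v)
  linarith [mul_pow ξ v 2]

/-- The real part of the difference of cumulants is `-∫ e^{lv} (1 - cos ξv) ν(dv)`, and `e^{lv} ≥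
e^{-1}` since `|l|` and `|v|` are at most `1`. -/
theorem norm_tiltedChar_le {l : ℝ} (hl : |l| ≤ 1) (ξ : ℝ) :
    ‖tiltedChar ν l ξ‖ ≤ Real.exp (-(Real.exp (-1) * ∫ v, (1 - Real.cos (ξ * v)) ∂ν)) := by
  rw [tiltedChar, Complex.norm_exp, Real.exp_le_exp]
  unfold cumulant
  rw [← integral_sub (hν.integrable_cumulant _) (hν.integrable_cumulant _),
    ← integral_const_mul, ← integral_neg]
  have hi := (hν.integrable_cumulant (l + ξ * Complex.I)).sub (hν.integrable_cumulant l)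
  have hre := integral_re hi
  simp only [Pi.sub_apply] at hre
  refine (hre.symm.trans_le ?_)
  refine integral_mono_ae hi.re ((hν.integrable_one_sub_cos ξ).const_mul _).neg ?_
  filter_upwards [hν.abs_le] with v hv
  have h1 : ((Complex.exp ((l + ξ * Complex.I) * v) - 1 - (l + ξ * Complex.I) * v -
      (Complex.exp (l * v) - 1 - l * v)) : ℂ).re = Real.exp (l * v) * (Real.cos (ξ * v) - 1) := by
    simp [Complex.exp_re]
    ring
  simp only [RCLike.re_eq_complex_re]
  rw [h1]
  have h2 : Real.exp (-1) ≤ Real.exp (l * v) := by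
    rw [Real.exp_le_exp]
    have : |l * v| ≤ 1 := by rw [abs_mul]; exact mul_le_one₀ hl (abs_nonneg _) hv
    exact (_root_.abs_le.1 this).1
  nlinarith [Real.cos_le_one (ξ * v)]

end IsSmallJumpMeasure

/-! ### Densities with exponential decay and their modes. -/

theorem integrable_comp_abs_of_integrableOn {f : ℝ → ℝ} (hf : IntegrableOn f (Set.Ioi 0)) :
    Integrable fun x : ℝ => f |x| := by
  have hpos : IntegrableOn (fun x : ℝ => f |x|) (Set.Ioi 0) :=
    hf.congr_fun (fun x hx => by rw [abs_of_pos hx]) measurableSet_Ioi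
  have hneg : IntegrableOn (fun x : ℝ => f |x|) (Set.Iic 0) := by
    rw [← integrableOn_Ici_iff_integrableOn_Ioi] at hpos
    have := hpos.comp_neg
    simpa using this
  rw [← integrableOn_univ, ← Set.Iic_union_Ioi (a := (0 : ℝ))]
  exact hneg.union hpos

theorem integrable_exp_neg_mul_abs_rpow {c α : ℝ} (hc : 0 < c) (hα : 0 < α) :
    Integrable fun x : ℝ => Real.exp (-c * |x| ^ α) := by
  have h := integrableOn_rpow_mul_exp_neg_mul_rpow (s := 0) (by norm_num) hα hc
  simpa using integrable_comp_abs_of_integrableOn h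

theorem integrable_abs_mul_exp_neg_mul_abs_rpow {c α : ℝ} (hc : 0 < c) (hα : 0 < α) :
    Integrable fun x : ℝ => |x| * Real.exp (-c * |x| ^ α) := by
  have h := integrableOn_rpow_mul_exp_neg_mul_rpow (s := 1) (by norm_num) hα hc
  simpa using integrable_comp_abs_of_integrableOn h

theorem integral_withDensity_ofReal {q : ℝ → ℝ} (hq : Continuous q) (h0 : ∀ x, 0 ≤ q x)
    (f : ℝ → ℝ) :
    ∫ x, f x ∂((volume : Measure ℝ).withDensity fun x => ENNReal.ofReal (q x)) =
      ∫ x, q x * f x := by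
  rw [integral_withDensity_eq_integral_toReal_smul (by fun_prop) (by simp)]
  congr 1
  ext x
  rw [ENNReal.toReal_ofReal (h0 x), smul_eq_mul]

theorem IsContDensity.integral_eq {ν : Measure ℝ} {q : ℝ → ℝ} (h : IsContDensity ν q)
    (f : ℝ → ℝ) : ∫ x, f x ∂ν = ∫ x, q x * f x := by
  conv_lhs => rw [h.eq_withDensity]
  exact integral_withDensity_ofReal h.continuous h.nonneg f

/-- A continuous probability density with exponential decay has a smallest mode, and its maximum
is bounded below in terms of the decay. -/
theorem exists_isLeast_mode {ν : Measure ℝ} [IsProbabilityMeasure ν] {q : ℝ → ℝ}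
    (hq : IsContDensity ν q) {b : ℝ} (hb : 0 < b) (hle : ∀ x, q x ≤ b * Real.exp (-|x|)) :
    ∃ xm, IsLeast {x : ℝ | ∀ x', q x' ≤ q x} xm ∧
      1 / (b * (∫ x : ℝ, Real.exp (-(1 / 2) * |x|)) ^ 2) ≤ q xm := by
  have h1 : ∫ x, q x = 1 := by
    have := hq.integral_eq (fun _ => 1)
    simpa using this.symm
  have hlim : Tendsto q (cocompact ℝ) (𝓝 0) := by
    refine squeeze_zero (fun x => hq.nonneg x) hle ?_
    have h2 : Tendsto (fun x : ℝ => Real.exp (-|x|)) (cocompact ℝ) (𝓝 0) :=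
      Real.tendsto_exp_neg_atTop_nhds_zero.comp (tendsto_norm_cocompact_atTop (E := ℝ))
    simpa using h2.const_mul b
  obtain ⟨x₀, hx₀⟩ : ∃ x₀, 0 < q x₀ := by
    by_contra! hcon
    have : q = fun _ => 0 := funext fun x => le_antisymm (hcon x) (hq.nonneg x)
    simp [this] at h1
  obtain ⟨x₁, hx₁⟩ := hq.continuous.exists_forall_ge' x₀
    ((hlim.eventually_lt_const hx₀).mono fun x hx => hx.le)
  have hS : 0 < q x₁ := hx₀.trans_le (hx₁ x₀)
  have hclosed : IsClosed {x : ℝ | ∀ x', q x' ≤ q x} := by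
    rw [Set.ofPred_forall]
    exact isClosed_iInter fun x' => isClosed_le continuous_const hq.continuous
  have hbdd : BddBelow {x : ℝ | ∀ x', q x' ≤ q x} := by
    -- At a maximiser `x`, the decay gives `q x₁ ≤ b e^{-|x|}`, so `|x| ≤ log (b / q x₁)`.
    refine ⟨-Real.log (b / q x₁), fun x hx => ?_⟩
    have h3 : q x₁ ≤ b * Real.exp (-|x|) := (hx x₁).trans (hle x)
    have h4 : Real.exp |x| ≤ b / q x₁ := by
      rw [le_div_iff₀ hS]
      calc Real.exp |x| * q x₁ ≤ Real.exp |x| * (b * Real.exp (-|x|)) := by gcongr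
        _ = b := by rw [mul_left_comm, ← Real.exp_add]; simp
    have h5 := (Real.le_log_iff_exp_le (by positivity)).2 h4
    linarith [neg_abs_le x]
  refine ⟨_, hclosed.isLeast_csInf ⟨x₁, hx₁⟩ hbdd, ?_⟩
  set xm := sInf {x : ℝ | ∀ x', q x' ≤ q x}
  have hmem : ∀ x', q x' ≤ q xm := (hclosed.isLeast_csInf ⟨x₁, hx₁⟩ hbdd).1
  have hSm : 0 < q xm := hS.trans_le (hmem x₁)
  have hint : Integrable fun x : ℝ => Real.exp (-(1 / 2) * |x|) := by
    simpa using integrable_exp_neg_mul_abs_rpow (c := 1 / 2) (α := 1) (by norm_num) one_pos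
  set N := ∫ x : ℝ, Real.exp (-(1 / 2) * |x|) with hN
  have hNpos : 0 < N := integral_exp_pos hint
  -- Geometric mean of the bounds `q ≤ q xm` and `q ≤ b e^{-|x|}`. It stays integrable, and
  -- integrating it against the unit mass of `q` bounds `q xm` from below.
  have h6 : ∀ x, q x ≤ Real.sqrt (q xm * b) * Real.exp (-(1 / 2) * |x|) := by
    intro x
    refine abs_le_of_sq_le_sq' ?_ (by positivity) |>.2
    rw [mul_pow, Real.sq_sqrt (by positivity), ← Real.exp_nat_mul, sq, mul_assoc]
    refine mul_le_mul (hmem x) ((hle x).trans_eq ?_) (hq.nonneg x) hSm.le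
    congr 2
    push_cast; ring
  have h7 : 1 ≤ Real.sqrt (q xm * b) * N := by
    rw [← h1, hN, ← integral_const_mul]
    exact integral_mono_of_nonneg (ae_of_all _ hq.nonneg) (hint.const_mul _) (ae_of_all _ h6)
  rw [div_le_iff₀ (by positivity)]
  calc (1 : ℝ) = 1 ^ 2 := by norm_num
    _ ≤ (Real.sqrt (q xm * b) * N) ^ 2 := by gcongr
    _ = q xm * (b * N ^ 2) := by rw [mul_pow, Real.sq_sqrt (by positivity)]; ring

/-! ### Density bounds uniform in the jump measure. -/

namespace IsSmallJumpMeasure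

variable {ν : Measure ℝ} (hν : IsSmallJumpMeasure ν)

include hν

/-- The growth hypothesis says nothing for `|ξ| < 1`; there the prefactor `exp (e⁻¹ c)` makes the
right side at least `1`. -/
theorem norm_tiltedChar_le_of_growth {c α : ℝ} (hα : 0 < α) (hc : 0 < c)
    (hgrow : ∀ ξ : ℝ, 1 ≤ |ξ| → c * |ξ| ^ α ≤ ∫ v, (1 - Real.cos (ξ * v)) ∂ν)
    {l : ℝ} (hl : |l| ≤ 1) (ξ : ℝ) :
    ‖tiltedChar ν l ξ‖ ≤
      Real.exp (Real.exp (-1) * c) * Real.exp (-(Real.exp (-1) * c) * |ξ| ^ α) := by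
  refine (hν.norm_tiltedChar_le hl ξ).trans ?_
  rw [← Real.exp_add, Real.exp_le_exp]
  have he := Real.exp_pos (-1)
  rcases le_total 1 |ξ| with h | h
  · nlinarith [mul_le_mul_of_nonneg_left (hgrow ξ h) he.le, mul_pos he hc]
  · have h1 : |ξ| ^ α ≤ 1 := Real.rpow_le_one (abs_nonneg _) h hα.le
    have h2 : 0 ≤ ∫ v, (1 - Real.cos (ξ * v)) ∂ν :=
      integral_nonneg fun v => by simpa using Real.cos_le_one (ξ * v)
    nlinarith [mul_nonneg he.le h2, mul_le_mul_of_nonneg_left h1 (mul_pos he hc).le]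

/-- This replaces a contour shift in the inversion integral. Both sides are continuous and, by
`integral_tilt`, agree against all smooth compactly supported functions. -/
theorem fourierDensity_tilt {l : ℝ} (hi₀ : Integrable (tiltedChar ν 0))
    (hi : Integrable (tiltedChar ν l)) (x : ℝ) :
    Real.exp (l * x) * fourierDensity (tiltedChar ν 0) x =
      Real.exp (cumulant ν l).re * fourierDensity (tiltedChar ν l) x := by
  obtain ⟨m₀, hm₀, h₀⟩ := hν.exists_charFun_eq_tiltedChar 0
  obtain ⟨m, hm, h⟩ := hν.exists_charFun_eq_tiltedChar l
  have d₀ := isContDensity_fourierDensity m₀ (h₀ ▸ hi₀)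
  have d := isContDensity_fourierDensity m (h ▸ hi)
  rw [h₀] at d₀
  rw [h] at d
  have c₀ := d₀.continuous
  have c := d.continuous
  set q₀ := fourierDensity (tiltedChar ν 0)
  set q := fourierDensity (tiltedChar ν l)
  have hcont : Continuous fun x => Real.exp (l * x) * q₀ x - Real.exp (cumulant ν l).re * q x := by
    fun_prop
  have hae : (fun x => Real.exp (l * x) * q₀ x - Real.exp (cumulant ν l).re * q x)
      =ᵐ[volume] fun _ => 0 := by
    refine ae_eq_zero_of_integral_contDiff_smul_eq_zero hcont.locallyIntegrable fun g hg hs => ?_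
    have hgc := hg.continuous
    have ht := hν.integral_tilt h₀ h hgc hs
    rw [d₀.integral_eq, d.integral_eq, ← integral_const_mul] at ht
    have i1 : Integrable fun x => q₀ x * (Real.exp (l * x) * g x) :=
      Continuous.integrable_of_hasCompactSupport (by fun_prop) (hs.mul_left.mul_left)
    have i2 : Integrable fun x => Real.exp (cumulant ν l).re * (q x * g x) :=
      Continuous.integrable_of_hasCompactSupport (by fun_prop) (hs.mul_left.mul_left)
    rw [← sub_eq_zero, ← integral_sub i1 i2] at ht
    rw [← ht]
    congr 1
    ext x
    rw [smul_eq_mul]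
    ring
  have := congrFun ((Continuous.ae_eq_iff_eq volume hcont continuous_const).1 hae) x
  linarith

end IsSmallJumpMeasure

/-- Uniform density estimates for centred infinitely divisible laws with small jumps: exponential
decay, and a lower bound near the smallest mode. The constants only depend on a bound for the
second moment and on the growth of the exponent. -/
theorem exists_uniform_density_bounds (K : ℝ) {c α : ℝ} (hc : 0 < c) (hα : 0 < α) :
    ∃ b₁ b₃ b₄ : ℝ, 0 < b₁ ∧ 0 < b₃ ∧ 0 < b₄ ∧ ∀ ν : Measure ℝ, IsSmallJumpMeasure ν →
      ∫ v, v ^ 2 ∂ν ≤ K →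
      (∀ ξ : ℝ, 1 ≤ |ξ| → c * |ξ| ^ α ≤ ∫ v, (1 - Real.cos (ξ * v)) ∂ν) →
      ∃ (m : Measure ℝ) (q : ℝ → ℝ) (xm : ℝ), IsProbabilityMeasure m ∧
        (∀ ξ : ℝ, charFun m ξ = Complex.exp (cumulant ν (ξ * Complex.I))) ∧
        IsContDensity m q ∧ (∀ x, q x ≤ b₁ * Real.exp (-|x|)) ∧
        IsLeast {x : ℝ | ∀ x', q x' ≤ q x} xm ∧ ∀ x, |x| ≤ b₄ → b₃ ≤ q (x + xm) := by
  set c' := Real.exp (-1) * c with hc'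
  have hc'pos : 0 < c' := by positivity
  set B : ℝ → ℝ := fun ξ => Real.exp c' * Real.exp (-c' * |ξ| ^ α) with hB
  have hBi : Integrable B := (integrable_exp_neg_mul_abs_rpow hc'pos hα).const_mul _
  have hBi' : Integrable fun ξ => |ξ| * B ξ := by
    refine ((integrable_abs_mul_exp_neg_mul_abs_rpow hc'pos hα).const_mul (Real.exp c')).congr
      (ae_of_all _ fun ξ => ?_)
    simp only [hB]
    ring
  have hB0 : ∀ ξ, 0 ≤ B ξ := fun ξ => by positivity
  set M := ∫ v, B (2 * Real.pi * v) with hM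
  have hM0 : 0 ≤ M := integral_nonneg fun v => hB0 _
  set D := ∫ v, |2 * Real.pi * v| * B (2 * Real.pi * v) with hD
  have hD0 : 0 ≤ D := integral_nonneg fun v => mul_nonneg (abs_nonneg _) (hB0 _)
  -- The first factor bounds the exponential moment of order `l` for `|l| ≤ 1`, and `M` bounds every
  -- tilted density. The `+ 1` gives positivity, as `M` is only known to be nonnegative.
  set b₁ := Real.exp (Real.exp 1 * K) * M + 1 with hb₁
  have hb₁pos : 0 < b₁ := by positivity
  set S := 1 / (b₁ * (∫ x : ℝ, Real.exp (-(1 / 2) * |x|)) ^ 2) with hS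
  have hSpos : 0 < S := by
    have hint : Integrable fun x : ℝ => Real.exp (-(1 / 2) * |x|) := by
      simpa using integrable_exp_neg_mul_abs_rpow (c := 1 / 2) (α := 1) (by norm_num) one_pos
    have := integral_exp_pos hint
    positivity
  -- `S` bounds the maximum from below and `D` is a Lipschitz constant, so moving from the mode by
  -- at most `S / 2 / (D + 1)` loses at most `S / 2`.
  refine ⟨b₁, S / 2, S / 2 / (D + 1), hb₁pos, by positivity, by positivity,
    fun ν hν hK hgrow => ?_⟩
  have hbound := fun {l : ℝ} (hl : |l| ≤ 1) ξ => hν.norm_tiltedChar_le_of_growth hα hc hgrow hl ξ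
  have hint : ∀ {l : ℝ}, |l| ≤ 1 → Integrable (tiltedChar ν l) := fun hl =>
    hBi.mono' (hν.continuous_tiltedChar _).aestronglyMeasurable (ae_of_all _ (hbound hl))
  have hi₀ := hint (l := 0) (by simp)
  obtain ⟨m, hm, h₀⟩ := hν.exists_charFun_eq_tiltedChar 0
  have d₀ := isContDensity_fourierDensity m (h₀ ▸ hi₀)
  rw [h₀] at d₀
  set q := fourierDensity (tiltedChar ν 0) with hq
  have hdecay : ∀ {l : ℝ}, |l| ≤ 1 → ∀ x, q x ≤ b₁ * Real.exp (-(l * x)) := by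
    intro l hl x
    have h1 := hν.fourierDensity_tilt hi₀ (hint hl) x
    have h2 : fourierDensity (tiltedChar ν l) x ≤ M := fourierDensity_le hBi (hbound hl) x
    have h3 : Real.exp (cumulant ν l).re ≤ Real.exp (Real.exp 1 * K) :=
      Real.exp_le_exp.2 (hν.re_cumulant_le hl hK)
    have h4 : Real.exp (l * x) * q x ≤ b₁ := by
      rw [h1]
      calc _ ≤ Real.exp (cumulant ν l).re * M := by gcongr
        _ ≤ Real.exp (Real.exp 1 * K) * M := by gcongr
        _ ≤ b₁ := by rw [hb₁]; linarith
    rw [Real.exp_neg, ← div_eq_mul_inv, le_div_iff₀ (Real.exp_pos _), mul_comm]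
    exact h4
  -- The tilts `l = 1` and `l = -1` control the right and left tails.
  have hdec : ∀ x, q x ≤ b₁ * Real.exp (-|x|) := by
    intro x
    rcases abs_choice x with h | h <;> rw [h]
    · simpa using hdecay (l := 1) (by simp) x
    · simpa using hdecay (l := -1) (by simp) x
  obtain ⟨xm, hleast, hlow⟩ := exists_isLeast_mode d₀ hb₁pos hdec
  refine ⟨m, q, xm, hm, fun ξ => ?_, d₀, hdec, hleast, fun x hx => ?_⟩
  · rw [h₀, tiltedChar]
    simp [cumulant]
  · have h5 := abs_fourierDensity_sub_le hi₀ hBi' (hbound (by simp)) (x + xm) xm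
    rw [add_sub_cancel_right] at h5
    have h6 : D * |x| ≤ S / 2 := by
      rw [le_div_iff₀ (by positivity)] at hx
      nlinarith [abs_nonneg x]
    have h7 := (abs_le.1 (h5.trans h6)).1
    have h8 : S ≤ q xm := hlow
    linarith

/-! ### Comparison of `Re ψ`, `ψ^L` and `ψ^U`, and growth of `ψ^U`. -/

theorem one_sub_cos_le (x : ℝ) : 1 - Real.cos x ≤ 2 * min (x ^ 2) 1 := by
  rcases le_total (x ^ 2) 1 with h | h
  · rw [min_eq_left h]
    nlinarith [Real.one_sub_sq_div_two_le_cos (x := x)]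
  · rw [min_eq_right h]
    linarith [Real.neg_one_le_cos x]

theorem sq_div_four_le_one_sub_cos {x : ℝ} (hx : |x| ≤ 1) : x ^ 2 / 4 ≤ 1 - Real.cos x := by
  have h := (abs_le.1 (Real.cos_bound hx)).2
  have h2 : |x| ^ 4 ≤ x ^ 2 := by
    have : |x| ^ 4 = x ^ 2 * x ^ 2 := by rw [← sq_abs x]; ring
    rw [this]
    exact mul_le_of_le_one_left (sq_nonneg x) ((sq_le_one_iff_abs_le_one x).2 hx)
  nlinarith [sq_nonneg x]

theorem min_sq_one_mul_le (c x : ℝ) : min ((c * x) ^ 2) 1 ≤ (1 + c ^ 2) * min 1 (x ^ 2) := by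
  rcases le_total 1 (x ^ 2) with h | h
  · rw [min_eq_left h]
    exact (min_le_right _ _).trans (by nlinarith [sq_nonneg c])
  · rw [min_eq_right h]
    refine (min_le_left _ _).trans ?_
    nlinarith [sq_nonneg x, mul_pow c x 2]

theorem psiU_nonneg (μ : Measure ℝ) (ξ : ℝ) : 0 ≤ psiU μ ξ :=
  integral_nonneg fun u => by positivity

namespace IsLevyMeasure

variable {μ : Measure ℝ} (hμ : IsLevyMeasure μ)

include hμ

theorem integrable_min : Integrable (fun u : ℝ => min 1 (u ^ 2)) μ := by
  refine ⟨by fun_prop, ?_⟩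
  rw [hasFiniteIntegral_iff_ofReal (ae_of_all _ fun u => by positivity)]
  exact hμ.lintegral_lt_top

theorem integrable_of_le {E : Type*} [NormedAddCommGroup E] {f : ℝ → E}
    (hf : AEStronglyMeasurable f μ) (C : ℝ) (h : ∀ u, ‖f u‖ ≤ C * min 1 (u ^ 2)) :
    Integrable f μ :=
  (hμ.integrable_min.const_mul C).mono' hf (ae_of_all _ h)

theorem integrable_psiU (ξ : ℝ) : Integrable (fun u : ℝ => min ((ξ * u) ^ 2) 1) μ := by
  refine hμ.integrable_of_le (by fun_prop) (1 + ξ ^ 2) fun u => ?_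
  rw [Real.norm_eq_abs, abs_of_nonneg (by positivity)]
  exact min_sq_one_mul_le ξ u

theorem integrable_one_sub_cos (ξ : ℝ) : Integrable (fun u => 1 - Real.cos (ξ * u)) μ := by
  refine ((hμ.integrable_psiU ξ).const_mul 2).mono' (by fun_prop) (ae_of_all _ fun u => ?_)
  rw [Real.norm_eq_abs, abs_of_nonneg (by linarith [Real.cos_le_one (ξ * u)])]
  exact one_sub_cos_le _

theorem integrableOn_psiL (ξ : ℝ) :
    IntegrableOn (fun u : ℝ => (ξ * u) ^ 2) {u : ℝ | |ξ * u| < 1} μ := by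
  refine (hμ.integrable_psiU ξ).integrableOn.congr_fun (fun u hu => ?_)
    (measurableSet_lt (by fun_prop) measurable_const)
  exact min_eq_left ((sq_le_one_iff_abs_le_one _).2 (le_of_lt hu))

theorem psiU_mono {ξ η : ℝ} (h : |ξ| ≤ |η|) : psiU μ ξ ≤ psiU μ η := by
  refine integral_mono (hμ.integrable_psiU ξ) (hμ.integrable_psiU η) fun u => ?_
  refine min_le_min_right _ (sq_le_sq.2 ?_)
  rw [abs_mul, abs_mul]
  gcongr

theorem psiU_two_mul_le (ξ : ℝ) : psiU μ (2 * ξ) ≤ 4 * psiU μ ξ := by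
  unfold psiU
  rw [← integral_const_mul]
  refine integral_mono (hμ.integrable_psiU _) ((hμ.integrable_psiU ξ).const_mul _) fun u => ?_
  change min ((2 * ξ * u) ^ 2) 1 ≤ 4 * min ((ξ * u) ^ 2) 1
  rcases le_total ((ξ * u) ^ 2) 1 with h | h
  · rw [min_eq_left h]
    exact (min_le_left _ _).trans_eq (by ring)
  · rw [min_eq_right h]
    exact (min_le_right _ _).trans (by norm_num)

/-- The gain under doubling: where `|2ξu| < 1` the integrand of `ψ^U(2ξ)` is four times that of
`ψ^U(ξ)`, so three quarters of it is surplus. -/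
theorem psiU_add_psiL_le (ξ : ℝ) : psiU μ ξ + 3 / 4 * psiL μ (2 * ξ) ≤ psiU μ (2 * ξ) := by
  have hs : MeasurableSet {u : ℝ | |2 * ξ * u| < 1} :=
    measurableSet_lt (by fun_prop) measurable_const
  unfold psiU psiL
  rw [← integral_indicator hs, ← integral_const_mul, ← integral_add (hμ.integrable_psiU ξ)
    (((integrable_indicator_iff hs).2 (hμ.integrableOn_psiL (2 * ξ))).const_mul _)]
  refine integral_mono ((hμ.integrable_psiU ξ).add
    (((integrable_indicator_iff hs).2 (hμ.integrableOn_psiL (2 * ξ))).const_mul _))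
    (hμ.integrable_psiU _) fun u => ?_
  change min ((ξ * u) ^ 2) 1 + 3 / 4 * _ ≤ min ((2 * ξ * u) ^ 2) 1
  by_cases h : |2 * ξ * u| < 1
  · rw [Set.indicator_of_mem (by exact h)]
    have h1 : (2 * ξ * u) ^ 2 ≤ 1 := (sq_le_one_iff_abs_le_one _).2 h.le
    rw [min_eq_left h1]
    have := min_le_left ((ξ * u) ^ 2) 1
    nlinarith
  · rw [Set.indicator_of_notMem (by exact h), mul_zero, add_zero]
    have h1 : 1 ≤ (2 * ξ * u) ^ 2 := (one_le_sq_iff_one_le_abs _).2 (not_lt.1 h)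
    rw [min_eq_right h1]
    exact min_le_right _ _

/-- The set `s` is left free so that the bound serves both for `Re ψ` on the whole line and for the
small jumps alone. -/
theorem psiL_div_four_le {ξ : ℝ} {s : Set ℝ}
    (hsub : {u : ℝ | |ξ * u| < 1} ⊆ s) :
    psiL μ ξ / 4 ≤ ∫ u in s, (1 - Real.cos (ξ * u)) ∂μ := by
  calc psiL μ ξ / 4 = ∫ u in {u : ℝ | |ξ * u| < 1}, (ξ * u) ^ 2 / 4 ∂μ := by
        rw [integral_div, psiL]
    _ ≤ ∫ u in {u : ℝ | |ξ * u| < 1}, (1 - Real.cos (ξ * u)) ∂μ := by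
        refine setIntegral_mono_on ((hμ.integrableOn_psiL ξ).div_const 4)
          (hμ.integrable_one_sub_cos ξ).integrableOn
          (measurableSet_lt (by fun_prop) measurable_const) fun u hu => ?_
        exact sq_div_four_le_one_sub_cos (le_of_lt hu)
    _ ≤ _ := by
        refine setIntegral_mono_set (hμ.integrable_one_sub_cos ξ).integrableOn
          (ae_of_all _ fun u => ?_) hsub.eventuallyLE
        simpa using Real.cos_le_one (ξ * u)

theorem integrable_levyExponent (ξ : ℝ) :
    Integrable (fun u : ℝ => 1 - Complex.exp (Complex.I * ξ * u) +
      Set.indicator {v : ℝ | |v| < 1} (fun v : ℝ => Complex.I * ξ * v) u) μ := by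
  refine hμ.integrable_of_le ?_ (2 + ξ ^ 2 * Real.exp |ξ|) fun u => ?_
  · refine AEStronglyMeasurable.add (by fun_prop) (AEStronglyMeasurable.indicator (by fun_prop) ?_)
    exact measurableSet_lt (by fun_prop) measurable_const
  · by_cases h : |u| < 1
    · rw [Set.indicator_of_mem (by exact h), min_eq_right ((sq_le_one_iff_abs_le_one u).2 h.le)]
      have h1 := norm_cumulant_integrand_le (Complex.I * ξ) h.le
      rw [← norm_neg] at h1
      have h2 : ‖Complex.I * (ξ : ℂ)‖ = |ξ| := by simp
      rw [h2, sq_abs] at h1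
      calc _ = ‖-(Complex.exp (Complex.I * ξ * u) - 1 - Complex.I * ξ * u)‖ := by congr 1; ring
        _ ≤ ξ ^ 2 * Real.exp |ξ| * u ^ 2 := h1
        _ ≤ _ := by nlinarith [sq_nonneg u]
    · rw [Set.indicator_of_notMem (by exact h), add_zero,
        min_eq_left ((one_le_sq_iff_one_le_abs u).2 (not_lt.1 h)), mul_one]
      have h1 : ‖Complex.exp (Complex.I * ξ * u)‖ = 1 := by simp [Complex.norm_exp]
      have h2 := norm_sub_le (1 : ℂ) (Complex.exp (Complex.I * ξ * u))
      rw [h1, norm_one] at h2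
      have : 0 ≤ ξ ^ 2 * Real.exp |ξ| := by positivity
      linarith

theorem re_levyExponent (a ξ : ℝ) :
    (levyExponent a μ ξ).re = ∫ u, (1 - Real.cos (ξ * u)) ∂μ := by
  have h := integral_re (hμ.integrable_levyExponent ξ)
  simp only [RCLike.re_eq_complex_re] at h
  rw [levyExponent, Complex.add_re, ← h]
  simp only [Complex.mul_re, Complex.I_re, Complex.I_im, Complex.ofReal_re, Complex.ofReal_im,
    Complex.mul_im]
  norm_num
  congr 1
  ext u
  by_cases h : |u| < 1
  · rw [Set.indicator_of_mem (by exact h)]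
    simp [Complex.exp_re]
  · rw [Set.indicator_of_notMem (by exact h)]
    simp [Complex.exp_re]

theorem re_levyExponent_le (a ξ : ℝ) : (levyExponent a μ ξ).re ≤ 2 * psiU μ ξ := by
  rw [hμ.re_levyExponent, psiU, ← integral_const_mul]
  exact integral_mono (hμ.integrable_one_sub_cos ξ) ((hμ.integrable_psiU ξ).const_mul 2)
    fun u => one_sub_cos_le _

theorem psiL_le (a ξ : ℝ) : psiL μ ξ / 4 ≤ (levyExponent a μ ξ).re := by
  rw [hμ.re_levyExponent]
  simpa using hμ.psiL_div_four_le (ξ := ξ) (Set.subset_univ _)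

/-- The starting value for the geometric growth: infinite mass with none at `0` puts mass where the
integrand is positive. -/
theorem psiU_one_pos (h : μ Set.univ = ∞) : 0 < psiU μ 1 := by
  unfold psiU
  rw [integral_pos_iff_support_of_nonneg (fun u => by positivity) (hμ.integrable_psiU 1)]
  have h1 : Function.support (fun u : ℝ => min ((1 * u) ^ 2) 1) = {0}ᶜ := by
    ext u
    simp only [Function.mem_support, Set.mem_compl_iff, Set.mem_singleton_iff]
    refine not_congr ⟨fun hu => ?_, fun hu => by simp [hu]⟩
    by_contra hne
    have : 0 < min ((1 * u) ^ 2) 1 := by positivity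
    exact this.ne' hu
  have h2 : μ Set.univ ≤ μ {0} + μ {0}ᶜ := by
    rw [← Set.union_compl_self {(0 : ℝ)}]
    exact measure_union_le _ _
  rw [h, hμ.zero, zero_add] at h2
  rw [h1]
  exact ENNReal.zero_lt_top.trans_le h2

/-- Condition A turns the surplus `(3/4) ψ^L(2ξ)` into at least `3/(4β)` of `ψ^U(2ξ)`; then iterate.
-/
theorem psiU_le_pow_mul {β : ℝ} (hβ : 1 < β) (hA : ∀ ξ, psiU μ ξ ≤ β * psiL μ ξ) (k : ℕ) (ξ : ℝ) :
    psiU μ ξ ≤ (1 - 3 / (4 * β)) ^ k * psiU μ (2 ^ k * ξ) := by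
  have hr : 0 ≤ 1 - 3 / (4 * β) := by
    rw [sub_nonneg, div_le_one (by positivity)]
    linarith
  have step : ∀ ξ, psiU μ ξ ≤ (1 - 3 / (4 * β)) * psiU μ (2 * ξ) := by
    intro ξ
    have h1 := hμ.psiU_add_psiL_le ξ
    have h2 : psiU μ (2 * ξ) / β ≤ psiL μ (2 * ξ) := by
      rw [div_le_iff₀ (by positivity), mul_comm (psiL μ _)]
      exact hA _
    have h3 : 3 / (4 * β) * psiU μ (2 * ξ) = 3 / 4 * (psiU μ (2 * ξ) / β) := by
      field_simp
    linarith
  induction k with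
  | zero => simp
  | succ k ih =>
    refine ih.trans ?_
    rw [pow_succ, mul_assoc]
    refine mul_le_mul_of_nonneg_left ((step _).trans_eq ?_) (pow_nonneg hr k)
    rw [pow_succ]
    ring_nf

/-! ### The scale `ρ_t`. -/

section rho

variable {β : ℝ} (hβ : 1 < β) (hA : ∀ ξ, psiU μ ξ ≤ β * psiL μ ξ) (hinf : μ Set.univ = ∞)
  (a : ℝ) {t : ℝ} (ht : 0 < t)

include hβ hA hinf ht

theorem rho_set_nonempty :
    {ξ : ℝ | 0 < ξ ∧ 1 / t ≤ (levyExponent a μ ξ).re}.Nonempty := by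
  have hp := hμ.psiU_one_pos hinf
  have hr1 : 1 - 3 / (4 * β) < 1 := by
    have : 0 < 3 / (4 * β) := by positivity
    linarith
  obtain ⟨k, hk⟩ := exists_pow_lt_of_lt_one (y := 1 - 3 / (4 * β))
    (show 0 < t * psiU μ 1 / (4 * β) by positivity) hr1
  refine ⟨2 ^ k, by positivity, ?_⟩
  refine le_trans ?_ (hμ.psiL_le a _)
  have h1 := hμ.psiU_le_pow_mul hβ hA k 1
  rw [mul_one] at h1
  have h2 := hA (2 ^ k)
  have h3 : psiU μ 1 ≤ t * psiU μ 1 / (4 * β) * psiU μ (2 ^ k) :=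
    h1.trans (mul_le_mul_of_nonneg_right hk.le (psiU_nonneg μ _))
  have h4 : 1 ≤ t / (4 * β) * psiU μ (2 ^ k) := by
    by_contra! hcon
    have : psiU μ 1 * (t / (4 * β) * psiU μ (2 ^ k)) < psiU μ 1 * 1 := by gcongr
    have h5 : t * psiU μ 1 / (4 * β) * psiU μ (2 ^ k) =
      psiU μ 1 * (t / (4 * β) * psiU μ (2 ^ k)) := by ring
    linarith
  rw [div_le_div_iff₀ ht (by norm_num)]
  have h6 : t / (4 * β) * psiU μ (2 ^ k) ≤ t / (4 * β) * (β * psiL μ (2 ^ k)) := by gcongr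
  have h7 : t / (4 * β) * (β * psiL μ (2 ^ k)) = psiL μ (2 ^ k) * t / 4 := by field_simp
  linarith

/-- The geometric bound read downwards: `ψ^U(2⁻ᵏ) ≤ rᵏ ψ^U(1)` is too small for any point below
`2⁻ᵏ` to reach the level `1/t`. -/
theorem rho_pos : 0 < rho a μ t := by
  have hp := hμ.psiU_one_pos hinf
  have hr1 : 1 - 3 / (4 * β) < 1 := by
    have : 0 < 3 / (4 * β) := by positivity
    linarith
  obtain ⟨k, hk⟩ := exists_pow_lt_of_lt_one (y := 1 - 3 / (4 * β))
    (show 0 < 1 / (2 * t * psiU μ 1) by positivity) hr1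
  have hk2 : (0 : ℝ) < (2 ^ k)⁻¹ := by positivity
  refine hk2.trans_le (le_csInf (hμ.rho_set_nonempty hβ hA hinf a ht) fun ξ hξ => ?_)
  by_contra! hlt
  have h1 := hξ.2.trans (hμ.re_levyExponent_le a ξ)
  have h2 : psiU μ ξ ≤ psiU μ (2 ^ k)⁻¹ :=
    hμ.psiU_mono (by rw [abs_of_pos hξ.1, abs_of_pos hk2]; exact hlt.le)
  have h3 := hμ.psiU_le_pow_mul hβ hA k (2 ^ k)⁻¹
  rw [mul_inv_cancel₀ (by positivity)] at h3
  have h4 : (1 - 3 / (4 * β)) ^ k * psiU μ 1 < 1 / (2 * t * psiU μ 1) * psiU μ 1 := by gcongr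
  have h5 : 1 / (2 * t * psiU μ 1) * psiU μ 1 = 1 / t / 2 := by field_simp
  linarith

/-- Some point below `2ρ_t` reaches the level `1/t`; two factors, `Re ψ ≤ 2ψ^U` and doubling, give
`8`. Comparing at neighbouring scales avoids continuity of `Re ψ`. -/
theorem one_le_mul_psiU_rho : 1 ≤ 8 * (t * psiU μ (rho a μ t)) := by
  have hρ := hμ.rho_pos hβ hA hinf a ht
  obtain ⟨ξ, hξ, hlt⟩ := exists_lt_of_csInf_lt (hμ.rho_set_nonempty hβ hA hinf a ht)
    (show sInf _ < 2 * rho a μ t by change rho a μ t < _; linarith)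
  have h1 := hξ.2.trans (hμ.re_levyExponent_le a ξ)
  have h2 : psiU μ ξ ≤ psiU μ (2 * rho a μ t) :=
    hμ.psiU_mono (by rw [abs_of_pos hξ.1, abs_of_pos (by positivity)]; exact hlt.le)
  have h3 := hμ.psiU_two_mul_le (rho a μ t)
  have h4 : 1 / t ≤ 8 * psiU μ (rho a μ t) := by linarith
  rw [div_le_iff₀ ht] at h4
  linarith

/-- Since `ρ_t / 2` lies below the infimum, `Re ψ(ρ_t / 2) < 1/t`. Doubling gives a factor `4`,
condition A a factor `β`, and `ψ^L ≤ 4 Re ψ` another `4`. -/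
theorem mul_psiU_rho_le : t * psiU μ (rho a μ t) ≤ 16 * β := by
  have hρ := hμ.rho_pos hβ hA hinf a ht
  have h1 : (levyExponent a μ (rho a μ t / 2)).re < 1 / t := by
    by_contra! hcon
    have : rho a μ t ≤ rho a μ t / 2 :=
      csInf_le ⟨0, fun ξ hξ => hξ.1.le⟩ ⟨by positivity, hcon⟩
    linarith
  have h2 := hμ.psiL_le a (rho a μ t / 2)
  have h3 := hμ.psiU_two_mul_le (rho a μ t / 2)
  rw [mul_div_cancel₀ _ two_ne_zero] at h3
  have h4 := hA (rho a μ t / 2)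
  have h5 : β * psiL μ (rho a μ t / 2) ≤ β * (4 * (1 / t)) := by gcongr; linarith
  calc t * psiU μ (rho a μ t) ≤ t * (4 * (β * (4 * (1 / t)))) := by gcongr; linarith
    _ = 16 * β := by field_simp; norm_num

/-- Polynomial growth of the rescaled exponent of the small jumps. -/
theorem growth_small_jumps {ξ : ℝ} (hξ : 1 ≤ |ξ|) :
    (1 - 3 / (4 * β)) / (32 * β) * |ξ| ^ Real.logb 2 (1 - 3 / (4 * β))⁻¹ ≤
      t * ∫ u in {u : ℝ | |rho a μ t * u| ≤ 1}, (1 - Real.cos (ξ * (rho a μ t * u))) ∂μ := by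
  have hρ := hμ.rho_pos hβ hA hinf a ht
  have hlow := hμ.one_le_mul_psiU_rho hβ hA hinf a ht
  set ρ := rho a μ t
  set r := 1 - 3 / (4 * β) with hr
  have hr0 : 0 < r := by
    rw [hr, sub_pos, div_lt_one (by positivity)]
    linarith
  have hr1 : r < 1 := by
    have : 0 < 3 / (4 * β) := by positivity
    rw [hr]; linarith
  -- Here `2^k ≤ |ξ| < 2^(k+1)`. The exponent `log₂ (1/r)` is chosen so that `2` raised to it is
  -- `1/r`; rounding down to `2^k` costs one factor `r` in the constant.
  obtain ⟨k, hk1, hk2⟩ := exists_nat_pow_near hξ (one_lt_two)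
  have hα : 0 ≤ Real.logb 2 r⁻¹ :=
    Real.logb_nonneg one_lt_two ((one_le_inv₀ hr0).2 hr1.le)
  have h1 : |ξ| ^ Real.logb 2 r⁻¹ ≤ (r⁻¹) ^ (k + 1) := by
    calc |ξ| ^ Real.logb 2 r⁻¹ ≤ ((2 : ℝ) ^ (k + 1)) ^ Real.logb 2 r⁻¹ :=
          Real.rpow_le_rpow (abs_nonneg _) hk2.le hα
      _ = ((2 : ℝ) ^ Real.logb 2 r⁻¹) ^ (k + 1) := by
          rw [← Real.rpow_natCast, ← Real.rpow_natCast, ← Real.rpow_mul (by norm_num),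
            ← Real.rpow_mul (by norm_num), mul_comm]
      _ = _ := by rw [Real.rpow_logb (by norm_num) (by norm_num) (by positivity)]
  have h2 : psiU μ ρ ≤ r ^ k * psiU μ (ξ * ρ) := by
    refine (hμ.psiU_le_pow_mul hβ hA k ρ).trans ?_
    refine mul_le_mul_of_nonneg_left (hμ.psiU_mono ?_) (by positivity)
    rw [abs_mul, abs_mul, abs_of_pos (by positivity : (0 : ℝ) < 2 ^ k)]
    gcongr
  -- For `|ξ| ≥ 1` the set `|ξρu| < 1` lies inside `|ρu| ≤ 1`, so discarding the big jumps loses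
  -- nothing of `ψ^L(ξρ)`.
  have h3 : psiL μ (ξ * ρ) / 4 ≤
      ∫ u in {u : ℝ | |ρ * u| ≤ 1}, (1 - Real.cos (ξ * ρ * u)) ∂μ := by
    refine hμ.psiL_div_four_le fun u hu => ?_
    have hu' : |ξ| * |ρ * u| < 1 := by rw [← abs_mul, ← mul_assoc]; exact hu
    change |ρ * u| ≤ 1
    nlinarith [abs_nonneg (ρ * u)]
  simp_rw [← mul_assoc ξ ρ]
  have h4 : psiU μ (ξ * ρ) ≤ β * psiL μ (ξ * ρ) := hA _
  calc r / (32 * β) * |ξ| ^ Real.logb 2 r⁻¹ ≤ r / (32 * β) * (r⁻¹) ^ (k + 1) := by gcongr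
    _ = (r ^ k)⁻¹ / (32 * β) * 1 := by rw [pow_succ, inv_pow]; field_simp
    _ ≤ (r ^ k)⁻¹ / (32 * β) * (8 * (t * (r ^ k * (β * psiL μ (ξ * ρ))))) := by
        gcongr
        refine hlow.trans ?_
        gcongr
        exact h2.trans (by gcongr)
    _ = t * (psiL μ (ξ * ρ) / 4) := by field_simp; ring
    _ ≤ _ := by gcongr

end rho

end IsLevyMeasure

/-! ### Rescaling to jumps of size at most `1`, and splitting off the big jumps. -/

/-- The jump measure `1_{|ρu| ≤ 1} t μ(du)` in the scale `v = ρ u`. -/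
noncomputable def scaledMeasure (μ : Measure ℝ) (ρ t : ℝ) : Measure ℝ :=
  ENNReal.ofReal t • (μ.restrict {u : ℝ | |ρ * u| ≤ 1}).map (fun u => ρ * u)

theorem integral_scaledMeasure (μ : Measure ℝ) (ρ : ℝ) {t : ℝ} (ht : 0 < t) {E : Type*}
    [NormedAddCommGroup E] [NormedSpace ℝ E] {f : ℝ → E} (hf : Continuous f)
    [SecondCountableTopology E] :
    ∫ v, f v ∂(scaledMeasure μ ρ t) = t • ∫ u in {u : ℝ | |ρ * u| ≤ 1}, f (ρ * u) ∂μ := by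
  rw [scaledMeasure, integral_smul_measure, ENNReal.toReal_ofReal ht.le,
    integral_map (by fun_prop) hf.aestronglyMeasurable]

theorem IsContDensity.map_inv_mul {m : Measure ℝ} {q : ℝ → ℝ} (h : IsContDensity m q) {ρ : ℝ}
    (hρ : 0 < ρ) : IsContDensity (m.map (fun x => ρ⁻¹ * x)) (fun x => ρ * q (ρ * x)) := by
  classical
  have hc := h.continuous
  refine ⟨by fun_prop, fun x => mul_nonneg hρ.le (h.nonneg _), ?_⟩
  ext s hs
  have hs' : MeasurableSet ((fun x => ρ⁻¹ * x) ⁻¹' s) := hs.preimage (by fun_prop)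
  rw [Measure.map_apply (by fun_prop) hs, h.eq_withDensity, withDensity_apply _ hs',
    withDensity_apply _ hs, ← lintegral_indicator hs', ← lintegral_indicator hs]
  have h1 : ∀ x, s.indicator (fun x => ENNReal.ofReal (ρ * q (ρ * x))) x =
      ((fun x => ρ⁻¹ * x) ⁻¹' s).indicator (fun y => ENNReal.ofReal (ρ * q y)) (ρ * x) := by
    intro x
    simp [Set.indicator_apply, hρ.ne']
  rw [lintegral_congr h1]
  rw [← lintegral_map (f := ((fun x => ρ⁻¹ * x) ⁻¹' s).indicator
      (fun y => ENNReal.ofReal (ρ * q y))) (Measurable.indicator (by fun_prop) hs')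
      (measurable_const_mul ρ), Real.map_volume_mul_left hρ.ne', lintegral_smul_measure,
      smul_eq_mul, ← lintegral_const_mul _ (Measurable.indicator (by fun_prop) hs')]
  refine lintegral_congr fun y => ?_
  rw [Set.indicator_apply, Set.indicator_apply]
  split_ifs
  · rw [abs_of_pos (inv_pos.2 hρ), ← ENNReal.ofReal_mul (by positivity)]
    congr 1
    field_simp
  · simp

theorem compoundWellDefined_of_bounded (σ : ℝ) {h : ℝ → ℝ} (hm : Measurable h) {C : ℝ}
    (hC : ∀ x, |h x| ≤ C) (ζ : ℝ) (Q : Measure ℝ) [IsFiniteMeasure Q] (x : ℝ) :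
    CompoundWellDefined σ h ζ Q x := by
  have hb : ∀ y, ‖σ * h ((x - y) * ζ)‖ ≤ |σ| * C := fun y => by
    rw [Real.norm_eq_abs, abs_mul]
    gcongr
    exact hC _
  refine ⟨inferInstance, fun m => ?_, ?_⟩
  · have hmeas : Measurable fun y => σ * h ((x - y) * ζ) := by fun_prop
    exact (integrable_const (|σ| * C)).mono' hmeas.aestronglyMeasurable (ae_of_all _ hb)
  · refine Summable.of_norm_bounded
      ((Real.summable_pow_div_factorial (Q.real Set.univ)).mul_left (|σ| * C)) fun m => ?_
    rw [compoundTerm, norm_mul, Real.norm_of_nonneg (by positivity)]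
    have h1 := norm_integral_le_of_norm_le_const (μ := convPow Q m) (ae_of_all _ hb)
    rw [measureReal_convPow] at h1
    calc _ ≤ 1 / (m.factorial : ℝ) * (|σ| * C * Q.real Set.univ ^ m) := by gcongr
      _ = _ := by ring

theorem integrable_compoundPoisson_of_bounded {Q : Measure ℝ} [IsFiniteMeasure Q] {f : ℝ → ℝ}
    (hf : Measurable f) {C : ℝ} (h : ∀ x, |f x| ≤ C) (m : ℕ) :
    Integrable f (compoundPoisson Q) ∧ Integrable f (convPow Q m) :=
  ⟨(integrable_const C).mono' (by fun_prop) (ae_of_all _ h),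
    (integrable_const C).mono' (by fun_prop) (ae_of_all _ h)⟩

namespace IsLevyMeasure

variable {μ : Measure ℝ} (hμ : IsLevyMeasure μ)

include hμ

theorem isSmallJumpMeasure_scaledMeasure (ρ : ℝ) (t : ℝ) :
    IsSmallJumpMeasure (scaledMeasure μ ρ t) := by
  have hs : MeasurableSet {u : ℝ | |ρ * u| ≤ 1} := measurableSet_le (by fun_prop) measurable_const
  constructor
  · refine Measure.ae_smul_measure ?_ _
    rw [ae_map_iff (by fun_prop) (measurableSet_le (by fun_prop) measurable_const)]
    exact ae_restrict_mem hs
  · refine Integrable.smul_measure ?_ ENNReal.ofReal_ne_top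
    rw [integrable_map_measure (by fun_prop) (by fun_prop)]
    refine (hμ.integrable_psiU ρ).integrableOn.congr_fun (fun u hu => ?_) hs
    exact min_eq_left ((sq_le_one_iff_abs_le_one _).2 hu)

theorem integral_sq_scaledMeasure_le (ρ : ℝ) {t : ℝ} (ht : 0 < t) :
    ∫ v, v ^ 2 ∂(scaledMeasure μ ρ t) ≤ t * psiU μ ρ := by
  have hs : MeasurableSet {u : ℝ | |ρ * u| ≤ 1} := measurableSet_le (by fun_prop) measurable_const
  rw [integral_scaledMeasure μ ρ ht (by fun_prop), smul_eq_mul]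
  refine mul_le_mul_of_nonneg_left ?_ ht.le
  calc ∫ u in {u : ℝ | |ρ * u| ≤ 1}, (ρ * u) ^ 2 ∂μ
      = ∫ u in {u : ℝ | |ρ * u| ≤ 1}, min ((ρ * u) ^ 2) 1 ∂μ :=
        setIntegral_congr_fun hs fun u hu =>
          (min_eq_left ((sq_le_one_iff_abs_le_one _).2 hu)).symm
    _ ≤ psiU μ ρ := setIntegral_le_integral (hμ.integrable_psiU ρ)
        (ae_of_all _ fun u => by positivity)

theorem isFiniteMeasure_bigJump (a t : ℝ) : IsFiniteMeasure (bigJump a μ t) := by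
  have h : μ {u : ℝ | 1 < |rho a μ t * u|} < ∞ := by
    refine (measure_mono fun u hu => ?_).trans_lt
      ((hμ.integrable_psiU (rho a μ t)).measure_norm_ge_lt_top one_pos)
    change (1 : ℝ) ≤ ‖min ((rho a μ t * u) ^ 2) 1‖
    rw [min_eq_right ((one_le_sq_iff_one_le_abs _).2 (le_of_lt hu))]
    simp
  refine ⟨?_⟩
  rw [bigJump, Measure.smul_apply, Measure.restrict_apply_univ, smul_eq_mul]
  exact ENNReal.mul_lt_top ENNReal.ofReal_lt_top h

/-- Markov's inequality: the integrand of `ψ^U(ρ_t)` equals `1` on the big jumps. With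
`mul_psiU_rho_le` this bounds the mass of `Λ_t` by `16β`. -/
theorem measureReal_bigJump_le (a : ℝ) {t : ℝ} (ht : 0 < t) :
    (bigJump a μ t).real Set.univ ≤ t * psiU μ (rho a μ t) := by
  rw [bigJump, measureReal_ennreal_smul_apply, ENNReal.toReal_ofReal ht.le,
    measureReal_restrict_apply_univ]
  refine mul_le_mul_of_nonneg_left ?_ ht.le
  have h := mul_meas_ge_le_integral_of_nonneg (ae_of_all _ fun u => by positivity)
    (hμ.integrable_psiU (rho a μ t)) 1
  rw [one_mul] at h
  refine le_trans (measureReal_mono (fun u hu => ?_) ?_) h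
  · change (1 : ℝ) ≤ min ((rho a μ t * u) ^ 2) 1
    rw [min_eq_right ((one_le_sq_iff_one_le_abs _).2 (le_of_lt hu))]
  · refine ne_of_lt ((measure_mono fun u hu => ?_).trans_lt
      ((hμ.integrable_psiU (rho a μ t)).measure_norm_ge_lt_top one_pos))
    exact le_trans (α := ℝ) hu (Real.le_norm_self _)

/-- The two truncations differ only between `1` and `1/ρ`. There `|u| ≤ ρ²u²` when `|u| < 1`, and
`|u| ≤ 1/ρ` otherwise. -/
theorem integrable_shift {ρ : ℝ} (hρ : 0 < ρ) :
    Integrable (fun u : ℝ => Set.indicator {v : ℝ | |v| < 1} (fun v => v) u -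
      Set.indicator {v : ℝ | |ρ * v| ≤ 1} (fun v => v) u) μ := by
  refine hμ.integrable_of_le ?_ (ρ ^ 2 + 1 / ρ) fun u => ?_
  · exact ((measurable_id.indicator (measurableSet_lt (by fun_prop) measurable_const)).sub
      (measurable_id.indicator
        (measurableSet_le (by fun_prop) measurable_const))).aestronglyMeasurable
  have hC : 0 ≤ (ρ ^ 2 + 1 / ρ) * min 1 (u ^ 2) := by positivity
  simp only [Set.indicator_apply, Set.mem_ofPred_eq]
  split_ifs with h1 h2 h2
  · simpa using hC
  · rw [min_eq_right ((sq_le_one_iff_abs_le_one u).2 h1.le), sub_zero, Real.norm_eq_abs]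
    have h3 : 1 ≤ (ρ * u) ^ 2 := (one_le_sq_iff_one_le_abs _).2 (not_le.1 h2).le
    have h4 : 0 ≤ 1 / ρ * u ^ 2 := by positivity
    nlinarith
  · rw [min_eq_left ((one_le_sq_iff_one_le_abs u).2 (not_lt.1 h1)), zero_sub, norm_neg,
      Real.norm_eq_abs, mul_one]
    rw [abs_mul, abs_of_pos hρ, mul_comm, ← le_div_iff₀ hρ] at h2
    nlinarith [sq_nonneg ρ]
  · simpa using hC

/-- Splitting the exponent into small jumps, big jumps and drift. -/
theorem mul_levyExponent_eq (a : ℝ) {t : ℝ} (ht : 0 < t) (hρ : 0 < rho a μ t) (ξ : ℝ) :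
    t * levyExponent a μ ξ = truncExponent a μ t ξ -
      ∫ v : ℝ, (Complex.exp (Complex.I * ξ * v) - 1) ∂(bigJump a μ t) +
      Complex.I * ξ * shift a μ t := by
  rw [levyExponent, truncExponent, bigJump, shift, integral_smul_measure,
    ENNReal.toReal_ofReal ht.le, Complex.real_smul]
  set ρ := rho a μ t
  have hA : MeasurableSet {u : ℝ | |ρ * u| ≤ 1} := measurableSet_le (by fun_prop) measurable_const
  have hB : MeasurableSet {u : ℝ | 1 < |ρ * u|} := measurableSet_lt measurable_const (by fun_prop)
  rw [← integral_indicator hA, ← integral_indicator hB]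
  have iF := hμ.integrable_levyExponent ξ
  have iH : Integrable ({u : ℝ | 1 < |ρ * u|}.indicator
      fun u : ℝ => Complex.exp (Complex.I * ξ * u) - 1) μ := by
    refine hμ.integrable_of_le (AEStronglyMeasurable.indicator (by fun_prop) hB)
      (2 * (1 + ρ ^ 2)) fun u => ?_
    by_cases h : 1 < |ρ * u|
    · rw [Set.indicator_of_mem (by exact h)]
      have h1 : ‖Complex.exp (Complex.I * ξ * u)‖ = 1 := by simp [Complex.norm_exp]
      have h2 := norm_sub_le (Complex.exp (Complex.I * ξ * u)) 1
      rw [h1, norm_one] at h2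
      have h3 := min_sq_one_mul_le ρ u
      rw [min_eq_right ((one_le_sq_iff_one_le_abs _).2 h.le)] at h3
      linarith
    · rw [Set.indicator_of_notMem (by exact h), norm_zero]
      positivity
  have iD := hμ.integrable_shift hρ
  have iD' : Integrable (fun u : ℝ => Complex.I * ξ *
      ((Set.indicator {v : ℝ | |v| < 1} (fun v => v) u -
      Set.indicator {v : ℝ | |ρ * v| ≤ 1} (fun v => v) u : ℝ) : ℂ)) μ := iD.ofReal.const_mul _
  have hpt : ∀ u : ℝ, {u : ℝ | |ρ * u| ≤ 1}.indicator
      (fun u : ℝ => 1 - Complex.exp (Complex.I * ξ * u) + Complex.I * ξ * u) u =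
      (1 - Complex.exp (Complex.I * ξ * u) +
        Set.indicator {v : ℝ | |v| < 1} (fun v : ℝ => Complex.I * ξ * v) u) +
      {u : ℝ | 1 < |ρ * u|}.indicator (fun u : ℝ => Complex.exp (Complex.I * ξ * u) - 1) u -
      Complex.I * ξ * ((Set.indicator {v : ℝ | |v| < 1} (fun v => v) u -
      Set.indicator {v : ℝ | |ρ * v| ≤ 1} (fun v => v) u : ℝ) : ℂ) := by
    intro u
    simp only [Set.indicator_apply, Set.mem_ofPred_eq]
    rcases le_or_gt |ρ * u| 1 with h | h
    · rw [if_pos h, if_neg h.not_gt, if_pos h]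
      split_ifs <;> push_cast <;> ring
    · rw [if_neg h.not_ge, if_pos h, if_neg h.not_ge]
      split_ifs <;> push_cast <;> ring
  simp_rw [hpt]
  have iFH : Integrable (fun u : ℝ => (1 - Complex.exp (Complex.I * ξ * u) +
        Set.indicator {v : ℝ | |v| < 1} (fun v : ℝ => Complex.I * ξ * v) u) +
      {u : ℝ | 1 < |ρ * u|}.indicator
        (fun u : ℝ => Complex.exp (Complex.I * ξ * u) - 1) u) μ := iF.add iH
  rw [integral_sub iFH iD', integral_add iF iH, integral_const_mul, integral_complex_ofReal]
  push_cast
  ring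

end IsLevyMeasure

theorem cumulant_scaledMeasure (a : ℝ) (μ : Measure ℝ) {t : ℝ} (ht : 0 < t)
    (hρ : 0 < rho a μ t) (ξ : ℝ) :
    cumulant (scaledMeasure μ (rho a μ t) t) (((rho a μ t)⁻¹ * ξ : ℝ) * Complex.I) =
      -truncExponent a μ t ξ := by
  rw [cumulant, integral_scaledMeasure μ _ ht (by fun_prop), truncExponent, Complex.real_smul,
    ← mul_neg, ← integral_neg]
  congr 2
  ext u
  have h : (((rho a μ t)⁻¹ * ξ : ℝ) : ℂ) * Complex.I * (rho a μ t * u : ℝ) =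
      Complex.I * ξ * u := by
    push_cast
    have : (rho a μ t : ℂ) ≠ 0 := by exact_mod_cast hρ.ne'
    field_simp
  rw [h]
  ring

end LevyKernel

/-! ### Assembling the two compound kernel estimates. -/

open LevyKernel in
theorem theorem2 {Ω : Type*} [MeasurableSpace Ω] (P : Measure Ω) [IsProbabilityMeasure P]
    (Z : ℝ≥0 → Ω → ℝ) (hZ : LevyKernel.IsLevyProcess Z P)
    (a : ℝ) (μ : Measure ℝ) (hμ : LevyKernel.IsLevyMeasure μ) (hμ_inf : μ Set.univ = ∞)
    (hψ : ∀ (t : ℝ≥0) (ξ : ℝ),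
      charFun (P.map (Z t)) ξ = Complex.exp (-((t : ℝ) * LevyKernel.levyExponent a μ ξ)))
    (hA : LevyKernel.ConditionA μ) :
    -- `p t` is the density of `Z_t`, `pbar t` that of the small-jump part, `xt t` its first mode;
    -- each of the three is uniquely determined for `t > 0` by its defining property
    ∃ (p pbar : ℝ → ℝ → ℝ) (xt : ℝ → ℝ),
      (∀ t : ℝ, 0 < t → 0 < LevyKernel.rho a μ t) ∧
      (∀ t : ℝ, 0 < t → LevyKernel.IsContDensity (P.map (Z t.toNNReal)) (p t)) ∧
      (∀ t : ℝ, 0 < t → ∃ ν : Measure ℝ, IsProbabilityMeasure ν ∧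
        (∀ ξ : ℝ, charFun ν ξ = Complex.exp (-LevyKernel.truncExponent a μ t ξ)) ∧
        LevyKernel.IsContDensity ν (pbar t)) ∧
      (∀ t : ℝ, 0 < t → IsLeast {x : ℝ | ∀ x' : ℝ, pbar t x' ≤ pbar t x} (xt t)) ∧
      ∀ t₀ : ℝ, 0 < t₀ → ∃ b₁ b₂ b₃ b₄ : ℝ, 0 < b₁ ∧ 0 < b₂ ∧ 0 < b₃ ∧ 0 < b₄ ∧
        LevyKernel.UpperCompoundKernelEstimate (Set.Ioc 0 t₀ ×ˢ Set.univ)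
          (fun t x => p t (x - LevyKernel.shift a μ t))
          (LevyKernel.rho a μ) (LevyKernel.fUpper b₁ b₂) (LevyKernel.rho a μ)
          (LevyKernel.bigJump a μ) ∧
        LevyKernel.LowerCompoundKernelEstimate (Set.Ioc 0 t₀ ×ˢ Set.univ)
          (fun t x => p t (x - LevyKernel.shift a μ t + xt t))
          (LevyKernel.rho a μ) (LevyKernel.fLower b₃ b₄) (LevyKernel.rho a μ)
          (LevyKernel.bigJump a μ) := by
  obtain ⟨β, hβ, hA⟩ := hA
  have hβ0 : 0 < β := by linarith
  have hr0 : 0 < 1 - 3 / (4 * β) := by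
    rw [sub_pos, div_lt_one (by positivity)]
    linarith
  have hr1 : 1 - 3 / (4 * β) < 1 := by
    have : 0 < 3 / (4 * β) := by positivity
    linarith
  have hα : 0 < Real.logb 2 (1 - 3 / (4 * β))⁻¹ :=
    Real.logb_pos one_lt_two ((one_lt_inv₀ hr0).2 hr1)
  obtain ⟨b₁, b₃, b₄, hb₁, hb₃, hb₄, hcore⟩ := exists_uniform_density_bounds (16 * β)
    (show 0 < (1 - 3 / (4 * β)) / (32 * β) by positivity) hα
  have hρ : ∀ t : ℝ, 0 < t → 0 < rho a μ t := fun t ht => hμ.rho_pos hβ hA hμ_inf a ht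
  -- Positivity of `t` is placed under the existential, with zero as default, so that choice yields
  -- functions on all of `ℝ`.
  have hex : ∀ t : ℝ, ∃ (m : Measure ℝ) (q : ℝ → ℝ) (xm : ℝ), 0 < t → IsProbabilityMeasure m ∧
      (∀ ξ : ℝ, charFun m ξ =
        Complex.exp (cumulant (scaledMeasure μ (rho a μ t) t) (ξ * Complex.I))) ∧
      IsContDensity m q ∧ (∀ x, q x ≤ b₁ * Real.exp (-|x|)) ∧
      IsLeast {x : ℝ | ∀ x', q x' ≤ q x} xm ∧ ∀ x, |x| ≤ b₄ → b₃ ≤ q (x + xm) := by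
    intro t
    by_cases ht : 0 < t
    · obtain ⟨m, q, xm, h⟩ := hcore (scaledMeasure μ (rho a μ t) t)
        (hμ.isSmallJumpMeasure_scaledMeasure _ _)
        ((hμ.integral_sq_scaledMeasure_le _ ht).trans (hμ.mul_psiU_rho_le hβ hA hμ_inf a ht))
        (fun ξ hξ => by
          rw [integral_scaledMeasure μ _ ht (by fun_prop), smul_eq_mul]
          exact hμ.growth_small_jumps hβ hA hμ_inf a ht hξ)
      exact ⟨m, q, xm, fun _ => h⟩
    · exact ⟨0, 0, 0, fun h => absurd h ht⟩
  choose m q xm hmq using hex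
  set pbar : ℝ → ℝ → ℝ := fun t x => rho a μ t * q t (rho a μ t * x) with hpbar
  have hfin : ∀ t, IsFiniteMeasure (bigJump a μ t) := hμ.isFiniteMeasure_bigJump a
  have hdens : ∀ t, 0 < t →
      IsContDensity ((m t).map fun x => (rho a μ t)⁻¹ * x) (pbar t) := fun t ht =>
    (hmq t ht).2.2.1.map_inv_mul (hρ t ht)
  have hbdd : ∀ t, 0 < t → ∀ x, pbar t x ≤ rho a μ t * b₁ := fun t ht x => by
    refine mul_le_mul_of_nonneg_left (((hmq t ht).2.2.2.1 _).trans ?_) (hρ t ht).le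
    exact mul_le_of_le_one_right hb₁.le (by simpa using by positivity)
  have hprob : ∀ t, 0 < t → IsProbabilityMeasure ((m t).map fun x => (rho a μ t)⁻¹ * x) := by
    intro t ht
    have := (hmq t ht).1
    exact Measure.isProbabilityMeasure_map (by fun_prop)
  have hchar : ∀ t, 0 < t → ∀ ξ, charFun ((m t).map fun x => (rho a μ t)⁻¹ * x) ξ =
      Complex.exp (-truncExponent a μ t ξ) := by
    intro t ht ξ
    rw [charFun_map_mul, (hmq t ht).2.1, cumulant_scaledMeasure a μ ht (hρ t ht)]
  -- The law of the big jumps together with the drift `-a_t`; convolving it with the small-jump law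
  -- gives the law of `Z_t`.
  set D : ℝ → Measure ℝ := fun t =>
    (compoundPoisson (bigJump a μ t)).map (fun y => y + -shift a μ t) with hD
  have hDprob : ∀ t, IsProbabilityMeasure (D t) := fun t =>
    Measure.isProbabilityMeasure_map (by fun_prop)
  set p : ℝ → ℝ → ℝ := fun t x => ∫ y, pbar t (x - y) ∂(D t) with hp
  have hpeq : ∀ t, 0 < t → ∀ x, p t (x - shift a μ t) =
      ∫ y, pbar t (x - y) ∂(compoundPoisson (bigJump a μ t)) := by
    intro t ht x
    have hc := (hdens t ht).continuous
    simp only [hp, hD]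
    rw [integral_map (by fun_prop) (by fun_prop)]
    congr 1
    ext y
    congr 1
    ring
  have habs : ∀ t, 0 < t → ∀ x, |pbar t x| ≤ rho a μ t * b₁ := fun t ht x => by
    rw [abs_of_nonneg ((hdens t ht).nonneg x)]
    exact hbdd t ht x
  refine ⟨p, pbar, fun t => (rho a μ t)⁻¹ * xm t, hρ, fun t ht => ?_,
    fun t ht => ⟨_, hprob t ht, hchar t ht, hdens t ht⟩, fun t ht => ⟨fun x' => ?_, fun x hx => ?_⟩,
    fun t₀ _ => ⟨b₁, 1, Real.exp (-(16 * β)) * b₃, b₄, hb₁, one_pos, by positivity, hb₄, ?_, ?_⟩⟩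
  · have hp1 := hprob t ht
    have hconv := (hdens t ht).conv (D := D t) (hbdd t ht)
    have hZm : IsProbabilityMeasure (P.map (Z t.toNNReal)) :=
      Measure.isProbabilityMeasure_map (hZ.measurable _).aemeasurable
    have heq : P.map (Z t.toNNReal) =
        ((m t).map fun x => (rho a μ t)⁻¹ * x).conv (D t) := by
      refine Measure.ext_of_charFun (funext fun ξ => ?_)
      rw [charFun_conv, hchar t ht, hψ, Real.coe_toNNReal _ ht.le,
        hμ.mul_levyExponent_eq a ht (hρ t ht)]
      simp only [hD]
      rw [charFun_map_add_const, charFun_compoundPoisson, ← Complex.exp_add, ← Complex.exp_add]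
      congr 1
      simp
      ring
    rw [heq]
    exact hconv
  · have h := (hmq t ht).2.2.2.2.1.1 (rho a μ t * x')
    have hne := (hρ t ht).ne'
    simp only [hpbar]
    rw [mul_inv_cancel_left₀ hne]
    exact mul_le_mul_of_nonneg_left h (hρ t ht).le
  · rw [inv_mul_le_iff₀ (hρ t ht)]
    refine (hmq t ht).2.2.2.2.1.2 fun y => ?_
    have h := hx ((rho a μ t)⁻¹ * y)
    simp only [hpbar] at h
    rw [mul_inv_cancel_left₀ (hρ t ht).ne'] at h
    exact le_of_mul_le_mul_left h (hρ t ht)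
  · rintro t x ⟨⟨ht, -⟩, -⟩
    have hc := (hdens t ht).continuous
    have hwd : CompoundWellDefined (rho a μ t) (fUpper b₁ 1) (rho a μ t) (bigJump a μ t) x := by
      refine compoundWellDefined_of_bounded _ (by unfold fUpper; fun_prop) (C := b₁) (fun y => ?_)
        _ _ _
      rw [fUpper, abs_of_nonneg (by positivity)]
      exact mul_le_of_le_one_right hb₁.le (by simp)
    refine ⟨hwd, ?_⟩
    simp only [hpeq t ht]
    have hi := integrable_compoundPoisson_of_bounded (Q := bigJump a μ t)
      (f := fun y => pbar t (x - y)) (by fun_prop) (fun y => habs t ht (x - y))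
    have hs := hasSum_integral_compoundPoisson (hi 0).1
    rw [← hs.tsum_eq]
    -- Termwise comparison: the factor `e^{-Λ_t(ℝ)}` is at most `1`, and `p̄_t` is dominated by the
    -- rescaled exponential.
    refine Summable.tsum_le_tsum (fun k => ?_) hs.summable hwd.summable
    rw [smul_eq_mul, compoundTerm]
    refine mul_le_mul ?_ ?_ (integral_nonneg fun y => (hdens t ht).nonneg _) (by positivity)
    · gcongr
      simp
    · refine integral_mono (hi k).2 (hwd.integrable k) fun y => ?_
      refine mul_le_mul_of_nonneg_left (((hmq t ht).2.2.2.1 _).trans_eq ?_) (hρ t ht).le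
      rw [fUpper, mul_comm (rho a μ t), neg_one_mul]
  · rintro t x ⟨⟨ht, -⟩, -⟩
    have hc := (hdens t ht).continuous
    have hwd : CompoundWellDefined (rho a μ t) (fLower (Real.exp (-(16 * β)) * b₃) b₄)
        (rho a μ t) (bigJump a μ t) x := by
      refine compoundWellDefined_of_bounded _ ?_ (C := Real.exp (-(16 * β)) * b₃) (fun y => ?_)
        _ _ _
      · exact (measurable_const.indicator
          (measurableSet_le (by fun_prop) measurable_const)).const_mul _
      · rw [fLower, Set.indicator_apply]
        split_ifs
        · rw [mul_one, abs_of_pos (by positivity)]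
        · rw [mul_zero, abs_zero]
          positivity
    refine ⟨hwd, ?_⟩
    simp only [sub_add_eq_add_sub, hpeq t ht]
    set xt := (rho a μ t)⁻¹ * xm t
    have hi := integrable_compoundPoisson_of_bounded (Q := bigJump a μ t)
      (f := fun y => pbar t (x + xt - y)) (by fun_prop) (fun y => habs t ht (x + xt - y))
    have hs := hasSum_integral_compoundPoisson (hi 0).1
    rw [← hs.tsum_eq]
    refine Summable.tsum_le_tsum (fun k => ?_) hwd.summable hs.summable
    rw [smul_eq_mul, compoundTerm, div_mul_eq_mul_div, div_mul_eq_mul_div, one_mul,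
      ← integral_const_mul]
    refine div_le_div_of_nonneg_right ?_ (by positivity)
    refine integral_mono (hwd.integrable k) ((hi k).2.const_mul _) fun y => ?_
    -- Here the Poisson normalisation cannot be dropped; the uniform bound on `Λ_t(ℝ)` keeps it away
    -- from `0`, whence the factor `e^{-16β}` in `b₃`.
    have hmass : Real.exp (-(16 * β)) ≤ Real.exp (-(bigJump a μ t).real Set.univ) := by
      rw [Real.exp_le_exp, neg_le_neg_iff]
      exact (hμ.measureReal_bigJump_le a ht).trans (hμ.mul_psiU_rho_le hβ hA hμ_inf a ht)
    have hpos := hρ t ht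
    change rho a μ t * fLower (Real.exp (-(16 * β)) * b₃) b₄ ((x - y) * rho a μ t) ≤
      Real.exp (-(bigJump a μ t).real Set.univ) * pbar t (x + xt - y)
    rw [fLower, Set.indicator_apply]
    split_ifs with h
    · have hq := (hmq t ht).2.2.2.2.2 _ h
      have harg : rho a μ t * (x + xt - y) = (x - y) * rho a μ t + xm t := by
        have : rho a μ t * xt = xm t := mul_inv_cancel_left₀ hpos.ne' _
        linear_combination this
      simp only [hpbar]
      rw [harg]
      calc _ = Real.exp (-(16 * β)) * (rho a μ t * b₃) := by ring
        _ ≤ _ := by gcongr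
    · rw [mul_zero, mul_zero]
      exact mul_nonneg (Real.exp_pos _).le ((hdens t ht).nonneg _)
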